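/- Let $k$ be a field of characteristic different from $2$, let $G$ be a finite group with neutral element $e$, and let $\omega: G\times G\times G\to k^*$ be a normalized $3$-cocycle, i.e. $\omega(x,y,z)=1$ whenever one of $x,y,z$ equals $e$, and $\omega(y,z,t)\,\omega(x,yz,t)\,\omega(x,y,z)=\omega(x,y,zt)\,\omega(xy,z,t)$ for all $x,y,z,t\in G$. Let $k^G_\omega$ be the algebra $k^G$ of functions on $G$, with basis $\{P_x\}_{x\in G}$ of delta functions, comultiplication $\Delta(P_g)=\sum_{xy=g}P_x\otimes P_y$ and counit $\varepsilon(f)=f(e)$, regarded as a quasi-Hopf algebra with reassociator $\Phi_\omega=\sum_{x,y,z\in G}\omega(x,y,z)\,P_x\otimes P_y\otimes P_z$. A braided Hopf algebra over $k^G_\omega$ is a Hopf algebra in the braided category of left Yetter--Drinfeld modules over $k^G_\omega$; a $2$-dimensional one is called non-trivial if it is not isomorphic to the group Hopf algebra $k[C_2]$ of the cyclic group of order $2$ with trivial action and trivial coaction. For $\mathfrak g\in G$ and $\rho: G\to k^*$ put $$\flat_{\mathfrak g}\omega(x,y)=\frac{\omega(\mathfrak g,x,y)\,\omega(x,y,\mathfrak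 g)}{\omega(x,\mathfrak g,y)},\qquad \partial\rho(x,y)=\rho(xy)^{-1}\rho(x)\rho(y)\qquad(x,y\in G).$$ Then the isomorphism classes of non-trivial $2$-dimensional braided Hopf algebras over $k^G_\omega$ are in one-to-one correspondence with the pairs $(\mathfrak g,\rho)$ consisting of an element $\mathfrak g$ of the center of $G$ and a map $\rho: G\to k^*$ such that $\rho(e)=1$, $\rho(\mathfrak g)=-1$ and $\flat_{\mathfrak g}\omega=\partial\rho$. The pair $(\mathfrak g,\rho)$ corresponds to the class of the following braided Hopf algebra: the vector space with basis $\{1,n\}$, with action $f\cdot 1=f(e)1$, $f\cdot n=f(\mathfrak g)n$ for $f\in k^G$, coaction $1\mapsto 1\otimes 1$, $n\mapsto \left(\sum_{x\in G}\rho(x)P_x\right)\otimes n$, unit $1$, multiplication given by $n^2=0$, comultiplication $1\mapsto 1\otimes 1$, $n\mapsto n\otimes 1+1\otimes n$, and counit $1\mapsto 1$, $n\mapsto 0$. -/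

import Mathlib

open scoped TensorProduct

universe u v w

noncomputable section

/-! ### Quasi-bialgebras -/

/-- A quasi-bialgebra structure `(Δ, ε, Φ)` on a `k`-algebra `H`. Threefold and fourfold tensor
powers are bracketed to the right; `Algebra.TensorProduct.assoc` only moves brackets. -/
structure QuasiBialgebra (k : Type u) [Field k] (H : Type v) [Ring H] [Algebra k H] where
  /-- the comultiplication `Δ` -/
  comul : H →ₐ[k] H ⊗[k] H
  /-- the counit `ε` -/
  counit : H →ₐ[k] k
  /-- the (invertible) reassociator `Φ = X¹ ⊗ X² ⊗ X³` -/
  Phi : (H ⊗[k] (H ⊗[k] H))ˣ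
  /-- `(id ⊗ Δ)(Δ h) = Φ (Δ ⊗ id)(Δ h) Φ⁻¹` -/
  quasi_coassoc : ∀ h : H,
    Algebra.TensorProduct.map (AlgHom.id k H) comul (comul h) =
      (Phi : H ⊗[k] (H ⊗[k] H)) *
        Algebra.TensorProduct.assoc k k k H H H
          (Algebra.TensorProduct.map comul (AlgHom.id k H) (comul h)) *
        ((Phi⁻¹ : (H ⊗[k] (H ⊗[k] H))ˣ) : H ⊗[k] (H ⊗[k] H))
  /-- `(id ⊗ ε)(Δ h) = h` -/
  comul_counit : ∀ h : H,
    Algebra.TensorProduct.rid k k H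
      (Algebra.TensorProduct.map (AlgHom.id k H) counit (comul h)) = h
  /-- `(ε ⊗ id)(Δ h) = h` -/
  counit_comul : ∀ h : H,
    Algebra.TensorProduct.lid k H
      (Algebra.TensorProduct.map counit (AlgHom.id k H) (comul h)) = h
  /-- `(id ⊗ ε ⊗ id)(Φ) = 1 ⊗ 1` -/
  Phi_normalized :
    Algebra.TensorProduct.map (AlgHom.id k H)
      ((Algebra.TensorProduct.lid k H).toAlgHom.comp
        (Algebra.TensorProduct.map counit (AlgHom.id k H)))
      (Phi : H ⊗[k] (H ⊗[k] H)) = 1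
  /-- `(1 ⊗ Φ) (id ⊗ Δ ⊗ id)(Φ) (Φ ⊗ 1) = (id ⊗ id ⊗ Δ)(Φ) (Δ ⊗ id ⊗ id)(Φ)` -/
  pentagon :
    ((1 : H) ⊗ₜ[k] (Phi : H ⊗[k] (H ⊗[k] H))) *
      Algebra.TensorProduct.map (AlgHom.id k H)
        ((Algebra.TensorProduct.assoc k k k H H H).toAlgHom.comp
          (Algebra.TensorProduct.map comul (AlgHom.id k H)))
        (Phi : H ⊗[k] (H ⊗[k] H)) *
      Algebra.TensorProduct.map (AlgHom.id k H)
        (Algebra.TensorProduct.assoc k k k H H H).toAlgHom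
        (Algebra.TensorProduct.assoc k k k H (H ⊗[k] H) H
          ((Phi : H ⊗[k] (H ⊗[k] H)) ⊗ₜ[k] (1 : H))) =
    Algebra.TensorProduct.map (AlgHom.id k H)
        (Algebra.TensorProduct.map (AlgHom.id k H) comul)
        (Phi : H ⊗[k] (H ⊗[k] H)) *
      Algebra.TensorProduct.assoc k k k H H (H ⊗[k] H)
        (Algebra.TensorProduct.map comul (AlgHom.id k (H ⊗[k] H))
          (Phi : H ⊗[k] (H ⊗[k] H)))

/-! ### Tensor products, associators, half-braidings

A left `H`-module structure on a vector space `V` is an algebra map `H →ₐ[k] Module.End k V`,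
a left coaction is a linear map `V →ₗ[k] H ⊗[k] V`. -/

section Modules

variable {k : Type u} [Field k] {H : Type v} [Ring H] [Algebra k H]

/-- The componentwise action `(a ⊗ b) · (v ⊗ w) = a · v ⊗ b · w` of `A ⊗ B` on `V ⊗ W`. -/
def tensorAct {A B V W : Type*} [Ring A] [Algebra k A] [Ring B] [Algebra k B]
    [AddCommGroup V] [Module k V] [AddCommGroup W] [Module k W]
    (a : A →ₐ[k] Module.End k V) (b : B →ₐ[k] Module.End k W) :
    A ⊗[k] B →ₐ[k] Module.End k (V ⊗[k] W) :=
  (Module.endTensorEndAlgHom (R := k) (S := k) (A := k) (M := V) (N := W)).comp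
    (Algebra.TensorProduct.map a b)

/-- The half-braiding `V ⊗ W → W ⊗ V`, `m ⊗ w ↦ m₍₋₁₎ · w ⊗ m₍₀₎`, of a space `V` with coaction
`coact` and an `H`-module `W`. -/
def halfBraid {V W : Type*} [AddCommGroup V] [Module k V] [AddCommGroup W] [Module k W]
    (coact : V →ₗ[k] H ⊗[k] V) (b : H →ₐ[k] Module.End k W) : V ⊗[k] W →ₗ[k] W ⊗[k] V :=
  (TensorProduct.lift b.toLinearMap).rTensor V ∘ₗ
    (TensorProduct.rightComm k H V W).toLinearMap ∘ₗ coact.rTensor W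

namespace QuasiBialgebra

variable (Q : QuasiBialgebra k H)

/-- The tensor product of two `H`-modules: `h · (v ⊗ w) = h₁ · v ⊗ h₂ · w`. -/
def tensorModule {V W : Type*} [AddCommGroup V] [Module k V] [AddCommGroup W] [Module k W]
    (a : H →ₐ[k] Module.End k V) (b : H →ₐ[k] Module.End k W) :
    H →ₐ[k] Module.End k (V ⊗[k] W) :=
  (tensorAct a b).comp Q.comul

/-- The associator `(x ⊗ y) ⊗ z ↦ X¹ · x ⊗ (X² · y ⊗ X³ · z)` of left `H`-modules. -/
def associator {V W U : Type*} [AddCommGroup V] [Module k V] [AddCommGroup W] [Module k W]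
    [AddCommGroup U] [Module k U] (a : H →ₐ[k] Module.End k V) (b : H →ₐ[k] Module.End k W)
    (c : H →ₐ[k] Module.End k U) : (V ⊗[k] W) ⊗[k] U →ₗ[k] V ⊗[k] (W ⊗[k] U) :=
  tensorAct a (tensorAct b c) (Q.Phi : H ⊗[k] (H ⊗[k] H)) ∘ₗ
    (TensorProduct.assoc k V W U).toLinearMap

/-- The inverse associator `x ⊗ (y ⊗ z) ↦ (x¹ · x ⊗ x² · y) ⊗ x³ · z`, where
`Φ⁻¹ = x¹ ⊗ x² ⊗ x³`. -/
def associatorInv {V W U : Type*} [AddCommGroup V] [Module k V] [AddCommGroup W] [Module k W]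
    [AddCommGroup U] [Module k U] (a : H →ₐ[k] Module.End k V) (b : H →ₐ[k] Module.End k W)
    (c : H →ₐ[k] Module.End k U) : V ⊗[k] (W ⊗[k] U) →ₗ[k] (V ⊗[k] W) ⊗[k] U :=
  (TensorProduct.assoc k V W U).symm.toLinearMap ∘ₗ
    tensorAct a (tensorAct b c)
      ((Q.Phi⁻¹ : (H ⊗[k] (H ⊗[k] H))ˣ) : H ⊗[k] (H ⊗[k] H))

/-- The trivial module structure `h · v = ε(h) v`. -/
def trivialAct (V : Type*) [AddCommGroup V] [Module k V] : H →ₐ[k] Module.End k V :=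
  (Algebra.ofId k (Module.End k V)).comp Q.counit

/-! ### Yetter-Drinfeld modules -/

/-- `V` with the action `act` and the coaction `coact`, `m ↦ m₍₋₁₎ ⊗ m₍₀₎`, is a left
Yetter-Drinfeld module over the quasi-bialgebra. -/
structure IsYetterDrinfeld {V : Type*} [AddCommGroup V] [Module k V]
    (act : H →ₐ[k] Module.End k V) (coact : V →ₗ[k] H ⊗[k] V) : Prop where
  /-- `ε(m₍₋₁₎) m₍₀₎ = m` -/
  counit_coact : ∀ m : V,
    TensorProduct.lid k V (Q.counit.toLinearMap.rTensor V (coact m)) = m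
  /-- `X¹ m₍₋₁₎ ⊗ (X² · m₍₀₎)₍₋₁₎ X³ ⊗ (X² · m₍₀₎)₍₀₎ =
  X¹ (Y¹ · m)₍₋₁₎₁ Y² ⊗ X² (Y¹ · m)₍₋₁₎₂ Y³ ⊗ X³ · (Y¹ · m)₍₀₎`: the two sides of the hexagon for
  `V` and two copies of the left regular module `H`, evaluated at `(m ⊗ 1) ⊗ 1`. -/
  coact_coassoc : ∀ m : V,
    (halfBraid coact (Algebra.lmul k H)).lTensor H
        (Q.associator (Algebra.lmul k H) act (Algebra.lmul k H)
          ((halfBraid coact (Algebra.lmul k H)).rTensor H ((m ⊗ₜ[k] (1 : H)) ⊗ₜ[k] (1 : H)))) =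
      Q.associator (Algebra.lmul k H) (Algebra.lmul k H) act
        (halfBraid coact (Q.tensorModule (Algebra.lmul k H) (Algebra.lmul k H))
          (Q.associator act (Algebra.lmul k H) (Algebra.lmul k H)
            ((m ⊗ₜ[k] (1 : H)) ⊗ₜ[k] (1 : H))))
  /-- `h₁ m₍₋₁₎ ⊗ h₂ · m₍₀₎ = (h₁ · m)₍₋₁₎ h₂ ⊗ (h₁ · m)₍₀₎` -/
  act_coact : ∀ (h : H) (m : V),
    tensorAct (Algebra.lmul k H) act (Q.comul h) (coact m) =
      halfBraid coact (Algebra.lmul k H)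
        (tensorAct act (Algebra.lmul k H) (Q.comul h) (m ⊗ₜ[k] (1 : H)))

/-- The coaction on the tensor product of two Yetter-Drinfeld modules:
`m ⊗ n ↦ X¹ (x¹ Y¹ · m)₍₋₁₎ x² (Y² · n)₍₋₁₎ Y³ ⊗ X² · (x¹ Y¹ · m)₍₀₎ ⊗ X³ x³ · (Y² · n)₍₀₎`. -/
def tensorCoact {V W : Type*} [AddCommGroup V] [Module k V] [AddCommGroup W] [Module k W]
    (a : H →ₐ[k] Module.End k V) (coactV : V →ₗ[k] H ⊗[k] V)
    (b : H →ₐ[k] Module.End k W) (coactW : W →ₗ[k] H ⊗[k] W) :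
    V ⊗[k] W →ₗ[k] H ⊗[k] (V ⊗[k] W) :=
  Q.associator (Algebra.lmul k H) a b ∘ₗ
    (halfBraid coactV (Algebra.lmul k H)).rTensor W ∘ₗ
    Q.associatorInv a (Algebra.lmul k H) b ∘ₗ
    (halfBraid coactW (Algebra.lmul k H)).lTensor V ∘ₗ
    Q.associator a b (Algebra.lmul k H) ∘ₗ
    (TensorProduct.mk k (V ⊗[k] W) H).flip 1

end QuasiBialgebra

/-- The trivial coaction `v ↦ 1 ⊗ v`. -/
def trivialCoact (k : Type u) [Field k] (H : Type v) [Ring H] [Algebra k H]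
    (V : Type*) [AddCommGroup V] [Module k V] : V →ₗ[k] H ⊗[k] V :=
  TensorProduct.mk k H V 1

/-- `f` is `H`-linear and `H`-colinear, i.e. a morphism of Yetter-Drinfeld modules. -/
structure IsYDHom {V W : Type*} [AddCommGroup V] [Module k V] [AddCommGroup W] [Module k W]
    (a : H →ₐ[k] Module.End k V) (coactV : V →ₗ[k] H ⊗[k] V)
    (b : H →ₐ[k] Module.End k W) (coactW : W →ₗ[k] H ⊗[k] W) (f : V →ₗ[k] W) : Prop where
  map_act : ∀ (h : H) (x : V), f (a h x) = b h (f x)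
  map_coact : ∀ x : V, coactW (f x) = f.lTensor H (coactV x)

end Modules

/-! ### Braided Hopf algebras -/

/-- The operations of a braided Hopf algebra over `H` on a vector space `V` (without axioms). -/
structure BraidedHopfData (k : Type u) [Field k] (H : Type v) [Ring H] [Algebra k H]
    (V : Type w) [AddCommGroup V] [Module k V] where
  /-- the `H`-action -/
  act : H →ₐ[k] Module.End k V
  /-- the `H`-coaction -/
  coact : V →ₗ[k] H ⊗[k] V
  /-- the multiplication -/
  mul : V ⊗[k] V →ₗ[k] V
  /-- the unit element -/
  one : V
  /-- the comultiplication -/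
  comul : V →ₗ[k] V ⊗[k] V
  /-- the counit -/
  counit : V →ₗ[k] k

section Hopf

variable {k : Type u} [Field k] {H : Type v} [Ring H] [Algebra k H]

/-- The multiplication of the tensor product algebra `B ⊗ B` in the braided category of
Yetter-Drinfeld modules: rebracket, braid the two middle factors, rebracket, and multiply. -/
def QuasiBialgebra.tensorMul (Q : QuasiBialgebra k H) {V : Type*} [AddCommGroup V] [Module k V]
    (D : BraidedHopfData k H V) : (V ⊗[k] V) ⊗[k] (V ⊗[k] V) →ₗ[k] V ⊗[k] V :=
  TensorProduct.map D.mul D.mul ∘ₗ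
    Q.associatorInv D.act D.act (Q.tensorModule D.act D.act) ∘ₗ
    (Q.associator D.act D.act D.act ∘ₗ
      (halfBraid D.coact D.act).rTensor V ∘ₗ
      Q.associatorInv D.act D.act D.act).lTensor V ∘ₗ
    Q.associator D.act D.act (Q.tensorModule D.act D.act)

/-- `V` with the operations `D` is a Hopf algebra in the category of left Yetter-Drinfeld modules
over the quasi-bialgebra `Q`. -/
structure IsBraidedHopf (Q : QuasiBialgebra k H) {V : Type*} [AddCommGroup V] [Module k V]
    (D : BraidedHopfData k H V) : Prop where
  yetterDrinfeld : Q.IsYetterDrinfeld D.act D.coact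
  -- algebra
  mul_hom : IsYDHom (Q.tensorModule D.act D.act) (Q.tensorCoact D.act D.coact D.act D.coact)
    D.act D.coact D.mul
  one_hom : IsYDHom (Q.trivialAct k) (trivialCoact k H k) D.act D.coact
    (LinearMap.toSpanSingleton k V D.one)
  one_mul : ∀ x : V, D.mul (D.one ⊗ₜ[k] x) = x
  mul_one : ∀ x : V, D.mul (x ⊗ₜ[k] D.one) = x
  mul_assoc : D.mul ∘ₗ D.mul.rTensor V =
    D.mul ∘ₗ D.mul.lTensor V ∘ₗ Q.associator D.act D.act D.act
  -- coalgebra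
  comul_hom : IsYDHom D.act D.coact (Q.tensorModule D.act D.act)
    (Q.tensorCoact D.act D.coact D.act D.coact) D.comul
  counit_hom : IsYDHom D.act D.coact (Q.trivialAct k) (trivialCoact k H k) D.counit
  counit_comul : ∀ x : V, TensorProduct.lid k V (D.counit.rTensor V (D.comul x)) = x
  comul_counit : ∀ x : V, TensorProduct.rid k V (D.counit.lTensor V (D.comul x)) = x
  comul_coassoc : Q.associator D.act D.act D.act ∘ₗ D.comul.rTensor V ∘ₗ D.comul =
    D.comul.lTensor V ∘ₗ D.comul
  -- the comultiplication and the counit are algebra morphisms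
  comul_one : D.comul D.one = D.one ⊗ₜ[k] D.one
  comul_mul : D.comul ∘ₗ D.mul = Q.tensorMul D ∘ₗ TensorProduct.map D.comul D.comul
  counit_one : D.counit D.one = 1
  counit_mul : ∀ x y : V, D.counit (D.mul (x ⊗ₜ[k] y)) = D.counit x * D.counit y
  -- antipode
  exists_antipode : ∃ S : V →ₗ[k] V, IsYDHom D.act D.coact D.act D.coact S ∧
    (∀ x : V, D.mul (S.rTensor V (D.comul x)) = D.counit x • D.one) ∧
    (∀ x : V, D.mul (S.lTensor V (D.comul x)) = D.counit x • D.one)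

/-- Two braided Hopf algebras are isomorphic: there is a linear bijection that is compatible with
the actions, the coactions, the products, the units, the coproducts and the counits. -/
def BraidedHopfData.Iso {V W : Type*} [AddCommGroup V] [Module k V] [AddCommGroup W] [Module k W]
    (D : BraidedHopfData k H V) (E : BraidedHopfData k H W) : Prop :=
  ∃ f : V ≃ₗ[k] W,
    IsYDHom D.act D.coact E.act E.coact f.toLinearMap ∧
    (∀ x y : V, f (D.mul (x ⊗ₜ[k] y)) = E.mul (f x ⊗ₜ[k] f y)) ∧
    f D.one = E.one ∧
    (∀ x : V, E.comul (f x) = TensorProduct.map f.toLinearMap f.toLinearMap (D.comul x)) ∧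
    (∀ x : V, E.counit (f x) = D.counit x)

/-- The group Hopf algebra `k[C₂]` with trivial action and trivial coaction. -/
def trivialC2 (Q : QuasiBialgebra k H) :
    BraidedHopfData k H (MonoidAlgebra k (Multiplicative (ZMod 2))) where
  act := Q.trivialAct _
  coact := trivialCoact k H _
  mul := LinearMap.mul' k _
  one := 1
  comul := Coalgebra.comul
  counit := Coalgebra.counit

/-- `V` with `D` is a `2`-dimensional braided Hopf algebra that is not isomorphic to the trivial
one, `k[C₂]`. -/
structure IsNontrivialTwoDim (Q : QuasiBialgebra k H) {V : Type*} [AddCommGroup V] [Module k V]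
    (D : BraidedHopfData k H V) : Prop where
  isHopf : IsBraidedHopf Q D
  finrank_eq : Module.finrank k V = 2
  nontrivial : ¬ D.Iso (trivialC2 Q)

/-- A non-trivial `2`-dimensional braided Hopf algebra over `Q`. -/
structure NontrivialTwoDimHopf (Q : QuasiBialgebra k H) where
  /-- the underlying vector space -/
  carrier : Type u
  [addCommGroup : AddCommGroup carrier]
  [module : Module k carrier]
  /-- the operations -/
  data : BraidedHopfData k H carrier
  isNontrivial : IsNontrivialTwoDim Q data

attribute [instance] NontrivialTwoDimHopf.addCommGroup NontrivialTwoDimHopf.module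

theorem BraidedHopfData.Iso.refl {V : Type*} [AddCommGroup V] [Module k V]
    (D : BraidedHopfData k H V) : D.Iso D := by
  refine ⟨LinearEquiv.refl k V, ⟨fun _ _ => rfl, fun x => ?_⟩, fun _ _ => rfl, rfl, fun x => ?_,
    fun _ => rfl⟩
  · simp
  · simp

theorem BraidedHopfData.Iso.symm {V W : Type*} [AddCommGroup V] [Module k V] [AddCommGroup W]
    [Module k W] {D : BraidedHopfData k H V} {E : BraidedHopfData k H W} (h : D.Iso E) :
    E.Iso D := by
  obtain ⟨f, ⟨h1, h2⟩, h3, h4, h5, h6⟩ := h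
  refine ⟨f.symm, ⟨fun a x => ?_, fun x => ?_⟩, fun x y => ?_, ?_, fun x => ?_, fun x => ?_⟩
  · apply f.injective
    have := h1 a (f.symm x)
    simp only [LinearEquiv.coe_coe, LinearEquiv.apply_symm_apply] at this ⊢
    exact this.symm
  · have := h2 (f.symm x)
    simp only [LinearEquiv.coe_coe, LinearEquiv.apply_symm_apply] at this ⊢
    rw [this, ← LinearMap.comp_apply, ← LinearMap.lTensor_comp]
    simp
  · apply f.injective
    simp [h3]
  · rw [← h4]; simp
  · have := h5 (f.symm x)
    simp only [LinearEquiv.apply_symm_apply] at this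
    rw [this, ← LinearMap.comp_apply, ← TensorProduct.map_comp]
    simp
  · have := h6 (f.symm x)
    simpa using this.symm

theorem BraidedHopfData.Iso.trans {V W U : Type*} [AddCommGroup V] [Module k V] [AddCommGroup W]
    [Module k W] [AddCommGroup U] [Module k U] {D : BraidedHopfData k H V}
    {E : BraidedHopfData k H W} {F : BraidedHopfData k H U} (h : D.Iso E) (h' : E.Iso F) :
    D.Iso F := by
  obtain ⟨f, ⟨h1, h2⟩, h3, h4, h5, h6⟩ := h
  obtain ⟨g, ⟨g1, g2⟩, g3, g4, g5, g6⟩ := h'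
  simp only [LinearEquiv.coe_coe] at h1 h2 g1 g2
  refine ⟨f.trans g, ⟨fun a x => ?_, fun x => ?_⟩, fun x y => ?_, ?_, fun x => ?_, fun x => ?_⟩
  · simp [h1, g1]
  · rw [LinearEquiv.coe_trans, LinearMap.lTensor_comp, LinearMap.comp_apply,
      LinearMap.comp_apply, ← h2]
    exact g2 (f x)
  · simp [h3, g3]
  · simp [h4, g4]
  · simp only [LinearEquiv.trans_apply, LinearEquiv.coe_trans, g5, h5]
    rw [← LinearMap.comp_apply, ← TensorProduct.map_comp]
  · simp [h6, g6]

/-- Isomorphism of non-trivial `2`-dimensional braided Hopf algebras over `Q`. -/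
def nontrivialTwoDimSetoid (Q : QuasiBialgebra k H) : Setoid (NontrivialTwoDimHopf Q) where
  r B B' := B.data.Iso B'.data
  iseqv := ⟨fun B => .refl B.data, fun h => h.symm, fun h h' => h.trans h'⟩

/-- The isomorphism classes of non-trivial `2`-dimensional braided Hopf algebras over `Q`. -/
def NontrivialTwoDimClasses (Q : QuasiBialgebra k H) :=
  Quotient (nontrivialTwoDimSetoid Q)

/-- The operations of `B_{σ,v}`: the vector space with basis `{1, n}`, realised as the algebra of
dual numbers, so that `n = DualNumber.eps` and `n² = 0`, with action `h · 1 = ε(h) 1`,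
`h · n = σ(h) n`, coaction `1 ↦ 1 ⊗ 1`, `n ↦ v ⊗ n`, comultiplication `1 ↦ 1 ⊗ 1`,
`n ↦ n ⊗ 1 + 1 ⊗ n`, and counit `1 ↦ 1`, `n ↦ 0`. -/
def twoDimData (Q : QuasiBialgebra k H) (σ : H →ₐ[k] k) (v : H) :
    BraidedHopfData k H (DualNumber k) where
  act := AlgHom.ofLinearMap
    (Q.counit.toLinearMap.smulRight
        ((TrivSqZeroExt.fstHom k k k).toLinearMap.smulRight (1 : DualNumber k)) +
      σ.toLinearMap.smulRight
        ((TrivSqZeroExt.sndHom k k).smulRight (DualNumber.eps : DualNumber k)))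
    (by ext x <;> simp)
    (by
      intro a b
      ext x <;> simp [mul_assoc])
  coact := (TrivSqZeroExt.fstHom k k k).toLinearMap.smulRight
      ((1 : H) ⊗ₜ[k] (1 : DualNumber k)) +
    (TrivSqZeroExt.sndHom k k).smulRight (v ⊗ₜ[k] (DualNumber.eps : DualNumber k))
  mul := LinearMap.mul' k (DualNumber k)
  one := 1
  comul := (TrivSqZeroExt.fstHom k k k).toLinearMap.smulRight
      ((1 : DualNumber k) ⊗ₜ[k] (1 : DualNumber k)) +
    (TrivSqZeroExt.sndHom k k).smulRight
      ((DualNumber.eps : DualNumber k) ⊗ₜ[k] (1 : DualNumber k) +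
        (1 : DualNumber k) ⊗ₜ[k] (DualNumber.eps : DualNumber k))
  counit := (TrivSqZeroExt.fstHom k k k).toLinearMap

end Hopf

/-! ### The quasi-bialgebra of functions on a finite group -/

section Functions

variable {k : Type u} [Field k] {G : Type v} [Group G]

/-- Normalized `3`-cocycles on `G` with values in `kˣ`. -/
structure IsNormalizedThreeCocycle (ω : G → G → G → kˣ) : Prop where
  one_left : ∀ y z, ω 1 y z = 1
  one_mid : ∀ x z, ω x 1 z = 1
  one_right : ∀ x y, ω x y 1 = 1
  cocycle : ∀ x y z t,
    ω y z t * ω x (y * z) t * ω x y z = ω x y (z * t) * ω (x * y) z t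

/-- `♭_g ω (x, y) = ω(g, x, y) ω(x, y, g) / ω(x, g, y)` -/
def flat (g : G) (ω : G → G → G → kˣ) (x y : G) : kˣ :=
  ω g x y * ω x y g / ω x g y

/-- `∂ρ (x, y) = ρ(xy)⁻¹ ρ(x) ρ(y)` -/
def coboundary (ρ : G → kˣ) (x y : G) : kˣ :=
  (ρ (x * y))⁻¹ * ρ x * ρ y

/-- The pairs `(g, ρ)` of a central element `g` and a map `ρ : G → kˣ` with `ρ(e) = 1`,
`ρ(g) = -1` and `♭_g ω = ∂ρ`. -/
def FlatPair (ω : G → G → G → kˣ) :=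
  {p : G × (G → kˣ) // p.1 ∈ Subgroup.center G ∧ p.2 1 = 1 ∧ p.2 p.1 = -1 ∧
    flat p.1 ω = coboundary p.2}

/-- Evaluation of the first tensor factor of `k^G ⊗ A` at `x : G`. -/
def evalLeft (k : Type u) [Field k] {G : Type v} {A : Type*} [Ring A] [Algebra k A] (x : G) :
    (G → k) ⊗[k] A →ₐ[k] A :=
  (Algebra.TensorProduct.lid k A).toAlgHom.comp
    (Algebra.TensorProduct.map (Pi.evalAlgHom k (fun _ : G => k) x) (AlgHom.id k A))

/-- The basis element `P_x` of `k^G`. -/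
def pt (k : Type u) [Field k] {G : Type v} [DecidableEq G] (x : G) : G → k := Pi.single x 1

/-- `∑ φ(x, y, z) P_x ⊗ P_y ⊗ P_z` -/
def funTensor {k : Type u} [Field k] {G : Type v} [Fintype G] [DecidableEq G]
    (φ : G → G → G → k) : (G → k) ⊗[k] ((G → k) ⊗[k] (G → k)) :=
  ∑ x, ∑ y, ∑ z, φ x y z • (pt k x ⊗ₜ[k] (pt k y ⊗ₜ[k] pt k z))

end Functions

section FunctionLemmas

variable {k : Type u} [Field k] {G : Type v} {A B : Type*} [Ring A] [Algebra k A]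
  [Ring B] [Algebra k B]

@[simp]
theorem evalLeft_tmul (x : G) (f : G → k) (a : A) :
    evalLeft k x (f ⊗ₜ[k] a) = f x • a := by
  simp [evalLeft]

theorem evalLeft_map_id (x : G) (F : A →ₐ[k] B) (w : (G → k) ⊗[k] A) :
    evalLeft k x (Algebra.TensorProduct.map (AlgHom.id k (G → k)) F w) = F (evalLeft k x w) := by
  induction w with
  | zero => simp
  | add a b ha hb => simp only [map_add, ha, hb]
  | tmul f a => simp

theorem evalLeft_assoc (x : G) (w : ((G → k) ⊗[k] A) ⊗[k] B) :
    evalLeft k x (Algebra.TensorProduct.assoc k k k (G → k) A B w) =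
      Algebra.TensorProduct.map (evalLeft k x) (AlgHom.id k B) w := by
  induction w with
  | zero => simp
  | add a b ha hb => simp only [map_add, ha, hb]
  | tmul z b =>
    induction z with
    | zero => simp
    | add a b ha hb => simp only [map_add, TensorProduct.add_tmul, ha, hb]
    | tmul f a => simp [TensorProduct.smul_tmul']

theorem evalLeft_map_left (y y' : G) (F : (G → k) →ₐ[k] (G → k)) (hF : ∀ f, F f y = f y')
    (w : (G → k) ⊗[k] A) :
    evalLeft k y (Algebra.TensorProduct.map F (AlgHom.id k A) w) = evalLeft k y' w := by
  induction w with
  | zero => simp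
  | add a b ha hb => simp only [map_add, ha, hb]
  | tmul f a => simp [hF]

variable [Fintype G] [DecidableEq G]

theorem sum_smul_pt (f : G → k) : ∑ x, f x • pt k x = f := by
  ext y
  simp [pt, Finset.sum_apply, Pi.single_apply]

theorem sum_pt_tmul_evalLeft (z : (G → k) ⊗[k] A) :
    ∑ x, pt k x ⊗ₜ[k] evalLeft k x z = z := by
  induction z with
  | zero => simp
  | add a b ha hb => simp only [map_add, TensorProduct.tmul_add, Finset.sum_add_distrib, ha, hb]
  | tmul f a =>
    simp only [evalLeft_tmul, ← TensorProduct.smul_tmul, ← TensorProduct.sum_tmul, sum_smul_pt]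

theorem evalLeft_ext {z z' : (G → k) ⊗[k] A}
    (h : ∀ x, evalLeft k x z = evalLeft k x z') : z = z' := by
  rw [← sum_pt_tmul_evalLeft z, ← sum_pt_tmul_evalLeft z']
  simp [h]

theorem evalLeft_funTensor (φ : G → G → G → k) (x y : G) :
    evalLeft k y (evalLeft k x (funTensor φ)) = φ x y := by
  ext z
  simp [funTensor, pt, Finset.sum_apply, Pi.single_apply, apply_ite, ite_apply]

theorem funTensor_mul (φ ψ : G → G → G → k) :
    funTensor φ * funTensor ψ = funTensor (fun x y z => φ x y z * ψ x y z) := by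
  refine evalLeft_ext fun x => evalLeft_ext fun y => ?_
  simp only [map_mul, evalLeft_funTensor]
  rfl

theorem funTensor_one : funTensor (fun _ _ _ : G => (1 : k)) = 1 := by
  refine evalLeft_ext fun x => evalLeft_ext fun y => ?_
  simp only [map_one, evalLeft_funTensor]
  rfl

end FunctionLemmas

section FunctionAlgebra

variable (k : Type u) [Field k] (G : Type v) [Group G] [Fintype G] [DecidableEq G]

/-- The comultiplication of `k^G`: `Δ(f) = ∑ f(xy) P_x ⊗ P_y`, so `Δ(P_g) = ∑_{xy=g} P_x ⊗ P_y`. -/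
def funComulLinear : (G → k) →ₗ[k] (G → k) ⊗[k] (G → k) where
  toFun f := ∑ x, ∑ y, f (x * y) • (pt k x ⊗ₜ[k] pt k y)
  map_add' f g := by simp [add_smul, Finset.sum_add_distrib]
  map_smul' c f := by simp [Finset.smul_sum, mul_smul]

variable {k G}

theorem evalLeft_funComulLinear (x : G) (f : G → k) :
    evalLeft k x (funComulLinear k G f) = fun y => f (x * y) := by
  ext y
  simp [funComulLinear, pt, Finset.sum_apply, Pi.single_apply, apply_ite, ite_apply]

/-- The comultiplication of `k^G` as an algebra map. -/
def funComul (k : Type u) [Field k] (G : Type v) [Group G] [Fintype G]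
    [DecidableEq G] : (G → k) →ₐ[k] (G → k) ⊗[k] (G → k) :=
  AlgHom.ofLinearMap (funComulLinear k G)
    (evalLeft_ext fun x => by rw [evalLeft_funComulLinear, map_one]; rfl)
    (fun f g => evalLeft_ext fun x => by
      rw [map_mul (evalLeft k x) (funComulLinear k G f) (funComulLinear k G g),
        evalLeft_funComulLinear, evalLeft_funComulLinear, evalLeft_funComulLinear]
      rfl)

theorem evalLeft_funComul (x : G) (f : G → k) :
    evalLeft k x (funComul k G f) = fun y => f (x * y) :=
  evalLeft_funComulLinear x f

theorem evalLeft_assoc_comul {A : Type*} [Ring A] [Algebra k A] (x y : G)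
    (w : (G → k) ⊗[k] A) :
    evalLeft k y (evalLeft k x (Algebra.TensorProduct.assoc k k k (G → k) (G → k) A
      (Algebra.TensorProduct.map (funComul k G) (AlgHom.id k A) w))) =
      evalLeft k (x * y) w := by
  rw [evalLeft_assoc, ← evalLeft_map_left y (x * y) ((evalLeft k x).comp (funComul k G))
    (fun f => by rw [AlgHom.comp_apply, evalLeft_funComul]) w]
  congr 1
  induction w with
  | zero => simp
  | add a b ha hb => simp only [map_add, ha, hb]
  | tmul f a => simp

/-- The reassociator `Φ_ω = ∑ ω(x, y, z) P_x ⊗ P_y ⊗ P_z`. -/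
def funPhi (ω : G → G → G → kˣ) : ((G → k) ⊗[k] ((G → k) ⊗[k] (G → k)))ˣ where
  val := funTensor fun x y z => (ω x y z : k)
  inv := funTensor fun x y z => ((ω x y z)⁻¹ : kˣ)
  val_inv := by
    rw [funTensor_mul, ← funTensor_one]
    simp
  inv_val := by
    rw [funTensor_mul, ← funTensor_one]
    simp

/-- The quasi-bialgebra `k^G_ω`: the algebra of functions on `G` with its usual comultiplication,
the counit `f ↦ f(e)` and the reassociator `Φ_ω`. -/
def funQuasiBialgebra (ω : G → G → G → kˣ) (hω : IsNormalizedThreeCocycle ω) :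
    QuasiBialgebra k (G → k) where
  comul := funComul k G
  counit := Pi.evalAlgHom k (fun _ : G => k) 1
  Phi := funPhi ω
  quasi_coassoc h := by
    rw [mul_comm (funPhi ω : (G → k) ⊗[k] ((G → k) ⊗[k] (G → k))), mul_assoc, Units.mul_inv,
      mul_one]
    refine evalLeft_ext fun x => evalLeft_ext fun y => ?_
    rw [evalLeft_assoc_comul, evalLeft_map_id, evalLeft_funComul, evalLeft_funComul,
      evalLeft_funComul]
    simp only [mul_assoc]
  comul_counit h := by
    ext x
    have key : ∀ z : (G → k) ⊗[k] (G → k), Algebra.TensorProduct.rid k k (G → k)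
        (Algebra.TensorProduct.map (AlgHom.id k (G → k))
          (Pi.evalAlgHom k (fun _ : G => k) 1) z) x = evalLeft k x z 1 := by
      intro z
      induction z with
      | zero => simp
      | add a b ha hb => simp only [map_add, Pi.add_apply, ha, hb]
      | tmul f a => simp [mul_comm]
    rw [key, evalLeft_funComul]
    simp only [mul_one]
  counit_comul h := by
    change evalLeft k 1 (funComul k G h) = h
    rw [evalLeft_funComul]
    simp
  Phi_normalized := by
    refine evalLeft_ext fun x => ?_
    rw [evalLeft_map_id, map_one]
    change evalLeft k 1 (evalLeft k x (funTensor fun x y z => (ω x y z : k))) = 1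
    rw [evalLeft_funTensor]
    ext z
    simp [hω.one_mid]
  pentagon := by
    have hP : ∀ x y, evalLeft k y (evalLeft k x
        (funPhi ω : (G → k) ⊗[k] ((G → k) ⊗[k] (G → k)))) = fun z => (ω x y z : k) :=
      fun x y => evalLeft_funTensor _ x y
    refine evalLeft_ext fun x => evalLeft_ext fun y => evalLeft_ext fun z => ?_
    simp only [map_mul]
    rw [evalLeft_assoc_comul, evalLeft_map_id, evalLeft_map_id, evalLeft_map_id, hP,
      evalLeft_map_id, hP, evalLeft_funComul]
    have h1 : evalLeft k z (evalLeft k y (evalLeft k x ((1 : G → k) ⊗ₜ[k]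
        (funPhi ω : (G → k) ⊗[k] ((G → k) ⊗[k] (G → k)))))) = fun t => (ω y z t : k) := by
      rw [evalLeft_tmul, Pi.one_apply, one_smul, hP]
    have h2 : evalLeft k z (evalLeft k y
        (((Algebra.TensorProduct.assoc k k k (G → k) (G → k) (G → k)).toAlgHom.comp
          (Algebra.TensorProduct.map (funComul k G) (AlgHom.id k (G → k))))
            (evalLeft k x (funPhi ω : (G → k) ⊗[k] ((G → k) ⊗[k] (G → k)))))) =
        fun t => (ω x (y * z) t : k) := by
      rw [← hP]
      exact evalLeft_assoc_comul y z _
    have h3 : evalLeft k z (evalLeft k y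
        ((Algebra.TensorProduct.assoc k k k (G → k) (G → k) (G → k)).toAlgHom
          (evalLeft k x (Algebra.TensorProduct.assoc k k k (G → k) ((G → k) ⊗[k] (G → k)) (G → k)
            ((funPhi ω : (G → k) ⊗[k] ((G → k) ⊗[k] (G → k))) ⊗ₜ[k] (1 : G → k)))))) =
        fun _ => (ω x y z : k) := by
      rw [evalLeft_assoc, Algebra.TensorProduct.map_tmul]
      refine (congrArg (evalLeft k z) (evalLeft_assoc y _)).trans ?_
      rw [Algebra.TensorProduct.map_tmul, hP, evalLeft_tmul]
      ext t
      simp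
    refine (congrArg₂ (· * ·) (congrArg₂ (· * ·) h1 h2) h3).trans ?_
    ext t
    have := congrArg (Units.val) (hω.cocycle x y z t)
    simpa using this

/-- The operations of the braided Hopf algebra `B_{g,ρ} = B_{σ,v}` over `k^G_ω`, where
`σ : f ↦ f(g)` and `v = ∑ ρ(x) P_x`. -/
def pairData (ω : G → G → G → kˣ) (hω : IsNormalizedThreeCocycle ω) (g : G) (ρ : G → kˣ) :
    BraidedHopfData k (G → k) (DualNumber k) :=
  twoDimData (funQuasiBialgebra ω hω) (Pi.evalAlgHom k (fun _ : G => k) g)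
    (fun x => (ρ x : k))

end FunctionAlgebra

end

/-! ### Homogeneous vectors and eigenvectors over the function algebra -/

section Eigenvectors

variable {k : Type u} [Field k] {G : Type v}
  {V W U : Type*} [AddCommGroup V] [Module k V] [AddCommGroup W] [Module k W]
  [AddCommGroup U] [Module k U]

/-! A module over `k^G` is a `G`-graded space, and the counit splits a two-dimensional braided Hopf
algebra as `k·1 ⊕ ker ε`. The kernel is a one-dimensional Yetter-Drinfeld submodule, so its
generator `n` has a degree `x` and a coaction `n ↦ r ⊗ n`. The unit and counit axioms leave only `n²
= ν n` and `Δ(n) = n ⊗ 1 + 1 ⊗ n + μ n ⊗ n` (`IsBraidedHopf.exists_isTwoDimForm`). The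
Yetter-Drinfeld axioms for `n` say that `r(1) = 1`, that `r` satisfies the relation `♭_x ω = ∂r`
(hence never vanishes), and that `x` is central.

If `ν` or `μ` is nonzero, a nonzero multiple of `n ⊗ n` or of `n` is carried by a morphism to a
vector of the other type. So `n` and `n ⊗ n` have the same degree and coaction, which forces `x = 1`
and `r = 1` (`eq_one_of_mul`, `eq_one_of_comul`). Comparing coefficients of `n ⊗ n` in `Δ(n²) =
Δ(n)²` gives `1 + r(x) + 3μν + (μν)² = 0` (`one_add_coact_eq`), here `(1 + μν)(2 + μν) = 0`. The
antipode excludes `μν = -1`, and `μν = -2` is the group algebra `k[C₂]` with `n = μ⁻¹(T - 1)`, where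
`T` is its generator. This is the trivial case. Hence non-triviality means `ν = μ = 0`, and the same
equation becomes `r(x) = -1`.

Conversely, when `ν = μ = 0` the associators act trivially wherever a factor `1` occurs, because `ω`
is normalized; associativity on `n ⊗ n ⊗ n` is saved by `n² = 0`. The pair `(x, r)` is an
isomorphism invariant because an isomorphism preserves the line `ker ε`. -/

/-- `v` is homogeneous of degree `x` for the `G`-grading that an action of `k^G` amounts to. -/
def IsHomogeneous (a : (G → k) →ₐ[k] Module.End k V) (x : G) (v : V) : Prop :=
  ∀ f : G → k, a f v = f x • v

/-- `v` is homogeneous of degree `x` and spans a subcomodule on which the coaction is `r`. -/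
structure IsEigenvector (a : (G → k) →ₐ[k] Module.End k V) (coact : V →ₗ[k] (G → k) ⊗[k] V)
    (x : G) (r : G → k) (v : V) : Prop where
  homogeneous : IsHomogeneous a x v
  coact_eq : coact v = r ⊗ₜ[k] v

theorem tensorAct_tmul_of_isHomogeneous {A : Type*} [Ring A] [Algebra k A]
    {a : (G → k) →ₐ[k] Module.End k V} (b : A →ₐ[k] Module.End k W) {x : G} {v : V}
    (hv : IsHomogeneous a x v) (w : W) (t : (G → k) ⊗[k] A) :
    tensorAct a b t (v ⊗ₜ[k] w) = v ⊗ₜ[k] b (evalLeft k x t) w := by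
  induction t with
  | zero => simp
  | add s t hs ht => simp only [map_add, LinearMap.add_apply, hs, ht, TensorProduct.tmul_add]
  | tmul f h =>
    change (a f v) ⊗ₜ[k] (b h w) = _
    rw [hv f, evalLeft_tmul, map_smul, LinearMap.smul_apply, TensorProduct.smul_tmul]

theorem halfBraid_tmul {coact : V →ₗ[k] (G → k) ⊗[k] V} {b : (G → k) →ₐ[k] Module.End k W}
    {r : G → k} {v : V} (hv : coact v = r ⊗ₜ[k] v) {x : G} {w : W} (hw : IsHomogeneous b x w) :
    halfBraid coact b (v ⊗ₜ[k] w) = r x • (w ⊗ₜ[k] v) := by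
  simp [halfBraid, hv, hw r, TensorProduct.smul_tmul']

theorem isHomogeneous_zero (a : (G → k) →ₐ[k] Module.End k V) (x : G) :
    IsHomogeneous a x 0 := fun f => by simp

namespace IsEigenvector

variable {a : (G → k) →ₐ[k] Module.End k V} {coact : V →ₗ[k] (G → k) ⊗[k] V}
  {x y : G} {r s : G → k} {v w : V}

theorem zero : IsEigenvector a coact x r 0 :=
  ⟨isHomogeneous_zero a x, by simp⟩

theorem add (hv : IsEigenvector a coact x r v) (hw : IsEigenvector a coact x r w) :
    IsEigenvector a coact x r (v + w) :=
  ⟨fun f => by simp [hv.homogeneous f, hw.homogeneous f],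
    by simp [hv.coact_eq, hw.coact_eq, TensorProduct.tmul_add]⟩

theorem smul (hv : IsEigenvector a coact x r v) (c : k) : IsEigenvector a coact x r (c • v) :=
  ⟨fun f => by simp [hv.homogeneous f, smul_comm c],
    by simp [hv.coact_eq]⟩

theorem sub (hv : IsEigenvector a coact x r v) (hw : IsEigenvector a coact x r w) :
    IsEigenvector a coact x r (v - w) := by
  simpa [sub_eq_add_neg] using hv.add (hw.smul (-1))

end IsEigenvector

/-- A functional that does not vanish on `v` contracts the second factor and recovers `h` up to a
nonzero scalar. -/
theorem tmul_right_injective {A : Type*} [AddCommGroup A] [Module k A] {v : V} (hv : v ≠ 0) :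
    Function.Injective fun h : A => h ⊗ₜ[k] v := by
  obtain ⟨φ, hφ⟩ := Module.Projective.exists_dual_ne_zero k hv
  intro h h' hh
  have := congrArg (TensorProduct.rid k A ∘ φ.lTensor A) hh
  simpa [hφ] using this

/-- The delta function at `x` detects the degree, and cancelling `v ≠ 0` from the coaction detects
its coefficient. Every later identification of types rests on this. -/
theorem IsEigenvector.unique {a : (G → k) →ₐ[k] Module.End k V}
    {coact : V →ₗ[k] (G → k) ⊗[k] V} {x y : G} {r s : G → k} {v : V} (hv : v ≠ 0)
    (h : IsEigenvector a coact x r v) (h' : IsEigenvector a coact y s v) : x = y ∧ r = s := by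
  classical
  constructor
  · have h1 := h.homogeneous (Pi.single x 1)
    rw [h'.homogeneous] at h1
    by_contra hne
    simp [Ne.symm hne, hv.symm] at h1
  · exact tmul_right_injective hv (h.coact_eq.symm.trans h'.coact_eq)

theorem IsYDHom.map_isEigenvector {a : (G → k) →ₐ[k] Module.End k V}
    {cV : V →ₗ[k] (G → k) ⊗[k] V} {b : (G → k) →ₐ[k] Module.End k W}
    {cW : W →ₗ[k] (G → k) ⊗[k] W} {f : V →ₗ[k] W} (hf : IsYDHom a cV b cW f) {x : G} {r : G → k}
    {v : V} (hv : IsEigenvector a cV x r v) : IsEigenvector b cW x r (f v) :=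
  ⟨fun h => by rw [← hf.map_act, hv.homogeneous, map_smul], by
    rw [hf.map_coact, hv.coact_eq, LinearMap.lTensor_tmul]⟩

/-- A linear map that maps the eigenvectors in a spanning family to eigenvectors of the same type
is a morphism of Yetter-Drinfeld modules. -/
theorem IsYDHom.of_span {a : (G → k) →ₐ[k] Module.End k V}
    {cV : V →ₗ[k] (G → k) ⊗[k] V} {b : (G → k) →ₐ[k] Module.End k W}
    {cW : W →ₗ[k] (G → k) ⊗[k] W} {f : V →ₗ[k] W} {ι : Type*} {e : ι → V}
    (he : Submodule.span k (Set.range e) = ⊤)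
    (h : ∀ i, ∃ x r, IsEigenvector a cV x r (e i) ∧ IsEigenvector b cW x r (f (e i))) :
    IsYDHom a cV b cW f := by
  constructor
  · intro φ
    refine LinearMap.congr_fun (f := f ∘ₗ a φ) (g := b φ ∘ₗ f) (LinearMap.ext_on_range he ?_)
    intro i
    obtain ⟨x, r, h1, h2⟩ := h i
    simp [h1.homogeneous φ, h2.homogeneous φ]
  · refine LinearMap.congr_fun (f := cW ∘ₗ f) (g := f.lTensor _ ∘ₗ cV)
      (LinearMap.ext_on_range he ?_)
    intro i
    obtain ⟨x, r, h1, h2⟩ := h i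
    simp [h1.coact_eq, h2.coact_eq]

variable [DecidableEq G]

theorem isHomogeneous_pt (x : G) : IsHomogeneous (Algebra.lmul k (G → k)) x (pt k x) := by
  intro f
  ext y
  by_cases h : y = x
  · subst h; simp [pt]
  · simp [pt, h]

variable [Fintype G]

theorem sum_pt : ∑ x : G, pt k x = 1 := by
  simpa using sum_smul_pt (1 : G → k)

/-- Since the delta functions sum to `1`, some `P_x` does not kill `n`. Then `P_x · n` is a nonzero
multiple of `n`, and it has degree `x` because `f P_x = f(x) P_x`. -/
theorem exists_isHomogeneous (a : (G → k) →ₐ[k] Module.End k V) {n : V} (hn : n ≠ 0)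
    (h : ∀ f, ∃ c : k, a f n = c • n) : ∃ x, IsHomogeneous a x n := by
  obtain ⟨x, hx⟩ : ∃ x, a (pt k x) n ≠ 0 := by
    by_contra! h0
    apply hn
    have h1 : ∑ x : G, a (pt k x) n = n := by
      rw [← LinearMap.sum_apply, ← map_sum, sum_pt, map_one, Module.End.one_apply]
    simpa [h0] using h1.symm
  obtain ⟨c, hc⟩ := h (pt k x)
  have hc0 : c ≠ 0 := by
    rintro rfl
    simp [hc] at hx
  refine ⟨x, fun f => ?_⟩
  have h2 : a f (a (pt k x) n) = f x • a (pt k x) n := by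
    rw [← Module.End.mul_apply, ← map_mul, ← LinearMap.smul_apply, ← map_smul]
    congr 2
    exact isHomogeneous_pt x f
  rw [hc, map_smul, smul_comm] at h2
  exact smul_right_injective V hc0 h2

theorem sum_sum_pt_tmul_ext {a b : G → G → k} {v : V} (hv : v ≠ 0)
    (h : ∑ x, ∑ y, a x y • (pt k x ⊗ₜ[k] (pt k y ⊗ₜ[k] v)) =
      ∑ x, ∑ y, b x y • (pt k x ⊗ₜ[k] (pt k y ⊗ₜ[k] v))) : a = b := by
  -- Regrouping the sum as `(∑ P_x ⊗ c x) ⊗ v` lets `v` be cancelled, after which evaluation at `x`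
  -- reads off the row `c x`.
  have key : ∀ c : G → G → k, ∑ x, ∑ y, c x y • (pt k x ⊗ₜ[k] (pt k y ⊗ₜ[k] v)) =
      TensorProduct.assoc k _ _ _ ((∑ x, pt k x ⊗ₜ[k] c x) ⊗ₜ[k] v) := by
    intro c
    rw [TensorProduct.sum_tmul, map_sum]
    refine Finset.sum_congr rfl fun x _ => ?_
    rw [TensorProduct.assoc_tmul]
    conv_rhs => rw [← sum_smul_pt (c x)]
    simp only [TensorProduct.sum_tmul, TensorProduct.tmul_sum, ← TensorProduct.smul_tmul',
      TensorProduct.tmul_smul]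
  rw [key, key, EmbeddingLike.apply_eq_iff_eq] at h
  have h := tmul_right_injective hv h
  ext1 x
  simpa [pt, Pi.single_apply] using congrArg (evalLeft k x) h

end Eigenvectors

/-! ### Associators, braidings and Yetter-Drinfeld axioms on homogeneous vectors -/

section FunctionModules

variable {k : Type u} [Field k] {G : Type v} [Group G] [Fintype G] [DecidableEq G]
  {ω : G → G → G → kˣ} {hω : IsNormalizedThreeCocycle ω}
  {V W U : Type*} [AddCommGroup V] [Module k V] [AddCommGroup W] [Module k W]
  [AddCommGroup U] [Module k U]
  {a : (G → k) →ₐ[k] Module.End k V} {b : (G → k) →ₐ[k] Module.End k W}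
  {c : (G → k) →ₐ[k] Module.End k U} {x y z : G} {v : V} {w : W} {u : U}

theorem associator_tmul (hv : IsHomogeneous a x v) (hw : IsHomogeneous b y w)
    (hu : IsHomogeneous c z u) :
    (funQuasiBialgebra ω hω).associator a b c ((v ⊗ₜ[k] w) ⊗ₜ[k] u) =
      (ω x y z : k) • (v ⊗ₜ[k] (w ⊗ₜ[k] u)) := by
  change tensorAct a (tensorAct b c) (funTensor fun x y z => (ω x y z : k))
    (v ⊗ₜ[k] (w ⊗ₜ[k] u)) = _
  rw [tensorAct_tmul_of_isHomogeneous _ hv, tensorAct_tmul_of_isHomogeneous _ hw,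
    evalLeft_funTensor, hu]
  simp

theorem associatorInv_tmul (hv : IsHomogeneous a x v) (hw : IsHomogeneous b y w)
    (hu : IsHomogeneous c z u) :
    (funQuasiBialgebra ω hω).associatorInv a b c (v ⊗ₜ[k] (w ⊗ₜ[k] u)) =
      ((ω x y z)⁻¹ : k) • ((v ⊗ₜ[k] w) ⊗ₜ[k] u) := by
  change (TensorProduct.assoc k V W U).symm
    (tensorAct a (tensorAct b c) (funTensor fun x y z => ((ω x y z)⁻¹ : kˣ))
    (v ⊗ₜ[k] (w ⊗ₜ[k] u))) = _
  rw [tensorAct_tmul_of_isHomogeneous _ hv, tensorAct_tmul_of_isHomogeneous _ hw,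
    evalLeft_funTensor, hu]
  simp

theorem IsHomogeneous.tmul (hv : IsHomogeneous a x v) (hw : IsHomogeneous b y w) :
    IsHomogeneous ((funQuasiBialgebra ω hω).tensorModule a b) (x * y) (v ⊗ₜ[k] w) := by
  intro f
  change tensorAct a b (funComul k G f) (v ⊗ₜ[k] w) = _
  rw [tensorAct_tmul_of_isHomogeneous _ hv, evalLeft_funComul, hw]
  simp

/-- The five factors of the coaction record the path of `P_z` from right to left: rebracket, pass
`w`, rebracket back, pass `v`, rebracket again. -/
theorem IsEigenvector.tmul {cV : V →ₗ[k] (G → k) ⊗[k] V} {cW : W →ₗ[k] (G → k) ⊗[k] W}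
    {r s : G → k} (hv : IsEigenvector a cV x r v) (hw : IsEigenvector b cW y s w) :
    IsEigenvector ((funQuasiBialgebra ω hω).tensorModule a b)
      ((funQuasiBialgebra ω hω).tensorCoact a cV b cW) (x * y)
      (fun z => ω x y z * s z * (ω x z y : k)⁻¹ * r z * ω z x y) (v ⊗ₜ[k] w) := by
  refine ⟨hv.homogeneous.tmul hw.homogeneous, ?_⟩
  have h1 : ∀ z, ((funQuasiBialgebra ω hω).associator (Algebra.lmul k (G → k)) a b ∘ₗ
      (halfBraid cV (Algebra.lmul k (G → k))).rTensor W ∘ₗ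
      (funQuasiBialgebra ω hω).associatorInv a (Algebra.lmul k (G → k)) b ∘ₗ
      (halfBraid cW (Algebra.lmul k (G → k))).lTensor V ∘ₗ
      (funQuasiBialgebra ω hω).associator a b (Algebra.lmul k (G → k)))
        ((v ⊗ₜ[k] w) ⊗ₜ[k] pt k z) =
      (ω x y z * s z * (ω x z y : k)⁻¹ * r z * ω z x y) • (pt k z ⊗ₜ[k] (v ⊗ₜ[k] w)) := by
    intro z
    have hz := isHomogeneous_pt (k := k) z
    simp only [LinearMap.comp_apply, associator_tmul hv.homogeneous hw.homogeneous hz, map_smul,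
      LinearMap.lTensor_tmul, LinearMap.rTensor_tmul, halfBraid_tmul hw.coact_eq hz,
      associatorInv_tmul hv.homogeneous hz hw.homogeneous, halfBraid_tmul hv.coact_eq hz,
      associator_tmul hz hv.homogeneous hw.homogeneous, TensorProduct.tmul_smul,
      ← TensorProduct.smul_tmul', smul_smul]
  -- The coaction is read off at `1` in the regular module, which is not homogeneous; its components
  -- `P_z` are.
  have h2 : (v ⊗ₜ[k] w) ⊗ₜ[k] (1 : G → k) = ∑ z, (v ⊗ₜ[k] w) ⊗ₜ[k] pt k z := by
    rw [← TensorProduct.tmul_sum, sum_pt]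
  change ((funQuasiBialgebra ω hω).associator (Algebra.lmul k (G → k)) a b ∘ₗ
      (halfBraid cV (Algebra.lmul k (G → k))).rTensor W ∘ₗ
      (funQuasiBialgebra ω hω).associatorInv a (Algebra.lmul k (G → k)) b ∘ₗ
      (halfBraid cW (Algebra.lmul k (G → k))).lTensor V ∘ₗ
      (funQuasiBialgebra ω hω).associator a b (Algebra.lmul k (G → k)))
        ((v ⊗ₜ[k] w) ⊗ₜ[k] 1) = _
  rw [h2, map_sum, Finset.sum_congr rfl fun z _ => h1 z]
  simp only [TensorProduct.smul_tmul', ← TensorProduct.sum_tmul]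
  rw [sum_smul_pt]

/-- Splitting both units into delta functions turns each side of the hexagon into a scalar multiple
of `P_y ⊗ P_z ⊗ v`, so coassociativity becomes a numerical relation between `r` and `ω`. -/
theorem coact_coassoc_lhs {cV : V →ₗ[k] (G → k) ⊗[k] V} {r : G → k}
    (hv : IsEigenvector a cV x r v) :
    (halfBraid cV (Algebra.lmul k (G → k))).lTensor (G → k)
        ((funQuasiBialgebra ω hω).associator (Algebra.lmul k (G → k)) a (Algebra.lmul k (G → k))
          ((halfBraid cV (Algebra.lmul k (G → k))).rTensor (G → k)
            ((v ⊗ₜ[k] (1 : G → k)) ⊗ₜ[k] (1 : G → k)))) =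
      ∑ y, ∑ z, (r y * ω y x z * r z) • (pt k y ⊗ₜ[k] (pt k z ⊗ₜ[k] v)) := by
  rw [← sum_pt]
  simp only [TensorProduct.tmul_sum, TensorProduct.sum_tmul, map_sum]
  rw [Finset.sum_comm]
  refine Finset.sum_congr rfl fun y _ => Finset.sum_congr rfl fun z _ => ?_
  have hy := isHomogeneous_pt (k := k) y
  have hz := isHomogeneous_pt (k := k) z
  simp only [LinearMap.rTensor_tmul, halfBraid_tmul hv.coact_eq hy, ← TensorProduct.smul_tmul',
    map_smul, associator_tmul hy hv.homogeneous hz, LinearMap.lTensor_tmul,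
    halfBraid_tmul hv.coact_eq hz, TensorProduct.tmul_smul, smul_smul]

theorem coact_coassoc_rhs {cV : V →ₗ[k] (G → k) ⊗[k] V} {r : G → k}
    (hv : IsEigenvector a cV x r v) :
    (funQuasiBialgebra ω hω).associator (Algebra.lmul k (G → k)) (Algebra.lmul k (G → k)) a
        (halfBraid cV ((funQuasiBialgebra ω hω).tensorModule (Algebra.lmul k (G → k))
            (Algebra.lmul k (G → k)))
          ((funQuasiBialgebra ω hω).associator a (Algebra.lmul k (G → k)) (Algebra.lmul k (G → k))
            ((v ⊗ₜ[k] (1 : G → k)) ⊗ₜ[k] (1 : G → k)))) =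
      ∑ y, ∑ z, (ω x y z * r (y * z) * ω y z x) • (pt k y ⊗ₜ[k] (pt k z ⊗ₜ[k] v)) := by
  rw [← sum_pt]
  simp only [TensorProduct.tmul_sum, TensorProduct.sum_tmul, map_sum]
  rw [Finset.sum_comm]
  refine Finset.sum_congr rfl fun y _ => Finset.sum_congr rfl fun z _ => ?_
  have hy := isHomogeneous_pt (k := k) y
  have hz := isHomogeneous_pt (k := k) z
  simp only [associator_tmul hv.homogeneous hy hz, map_smul,
    halfBraid_tmul hv.coact_eq (hy.tmul (hω := hω) hz), associator_tmul hy hz hv.homogeneous,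
    smul_smul]

/-- This side of the compatibility axiom sees `h(yx)`, whereas the other side sees `h(xy)`. Where
`r` does not vanish, the axiom therefore expresses that `x` commutes with `y`. -/
theorem act_coact_lhs {cV : V →ₗ[k] (G → k) ⊗[k] V} {r : G → k}
    (hv : IsEigenvector a cV x r v) (h : G → k) :
    tensorAct (Algebra.lmul k (G → k)) a (funComul k G h) (cV v) =
      (fun y => r y * h (y * x)) ⊗ₜ[k] v := by
  rw [hv.coact_eq]
  conv_lhs => rw [← sum_smul_pt r]
  conv_rhs => rw [← sum_smul_pt fun y => r y * h (y * x)]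
  simp only [TensorProduct.sum_tmul, map_sum]
  refine Finset.sum_congr rfl fun y _ => ?_
  rw [← TensorProduct.smul_tmul', map_smul, tensorAct_tmul_of_isHomogeneous _ (isHomogeneous_pt y),
    evalLeft_funComul, hv.homogeneous]
  simp only [TensorProduct.tmul_smul, TensorProduct.smul_tmul', smul_smul]

theorem act_coact_rhs {cV : V →ₗ[k] (G → k) ⊗[k] V} {r : G → k}
    (hv : IsEigenvector a cV x r v) (h : G → k) :
    halfBraid cV (Algebra.lmul k (G → k))
        (tensorAct a (Algebra.lmul k (G → k)) (funComul k G h) (v ⊗ₜ[k] (1 : G → k))) =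
      (fun y => r y * h (x * y)) ⊗ₜ[k] v := by
  rw [← sum_pt]
  conv_rhs => rw [← sum_smul_pt fun y => r y * h (x * y)]
  simp only [TensorProduct.sum_tmul, TensorProduct.tmul_sum, map_sum]
  refine Finset.sum_congr rfl fun y _ => ?_
  rw [tensorAct_tmul_of_isHomogeneous _ hv.homogeneous, evalLeft_funComul, isHomogeneous_pt,
    TensorProduct.tmul_smul, map_smul, halfBraid_tmul hv.coact_eq (isHomogeneous_pt y), smul_smul,
    mul_comm, TensorProduct.smul_tmul']

/-- Only `v₂` is braided, past `v₃`, so only `v₂` needs a known coaction and the braiding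
contributes `r x₃`; the other scalars come from rebracketing. -/
theorem tensorMul_tmul {D : BraidedHopfData k (G → k) V} {v₁ v₂ v₃ v₄ : V} {x₁ x₂ x₃ x₄ : G}
    {r : G → k} (h₁ : IsHomogeneous D.act x₁ v₁) (h₂ : IsEigenvector D.act D.coact x₂ r v₂)
    (h₃ : IsHomogeneous D.act x₃ v₃) (h₄ : IsHomogeneous D.act x₄ v₄) :
    (funQuasiBialgebra ω hω).tensorMul D ((v₁ ⊗ₜ[k] v₂) ⊗ₜ[k] (v₃ ⊗ₜ[k] v₄)) =
      (ω x₁ x₂ (x₃ * x₄) * (ω x₂ x₃ x₄ : k)⁻¹ * r x₃ * ω x₃ x₂ x₄ *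
        (ω x₁ x₃ (x₂ * x₄) : k)⁻¹) • (D.mul (v₁ ⊗ₜ[k] v₃) ⊗ₜ[k] D.mul (v₂ ⊗ₜ[k] v₄)) := by
  simp only [QuasiBialgebra.tensorMul, LinearMap.comp_apply,
    associator_tmul h₁ h₂.homogeneous (h₃.tmul (hω := hω) h₄), map_smul,
    LinearMap.lTensor_tmul, associatorInv_tmul h₂.homogeneous h₃ h₄, LinearMap.rTensor_tmul,
    halfBraid_tmul h₂.coact_eq h₃, ← TensorProduct.smul_tmul', TensorProduct.tmul_smul,
    associator_tmul h₃ h₂.homogeneous h₄,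
    associatorInv_tmul h₁ h₃ (h₂.homogeneous.tmul (hω := hω) h₄), TensorProduct.map_tmul,
    smul_smul, mul_assoc]

end FunctionModules

/-! ### Normal form of a two-dimensional braided Hopf algebra -/

section TwoDimensional

variable {k : Type u} [Field k] {G : Type v} [Group G]
  {V W : Type*} [AddCommGroup V] [Module k V] [AddCommGroup W] [Module k W]

/-- The basis `B = {1, n}` exhibits `D` as the structure with `n` homogeneous of degree `x` and
with coaction `r`, `n² = ν n` and `Δ(n) = n ⊗ 1 + 1 ⊗ n + μ n ⊗ n`. -/
structure IsTwoDimForm (D : BraidedHopfData k (G → k) V) (B : Module.Basis (Fin 2) k V) (x : G)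
    (r : G → k) (ν μ : k) : Prop where
  one_eq : D.one = B 0
  isEigenvector_one : IsEigenvector D.act D.coact 1 1 (B 0)
  isEigenvector : IsEigenvector D.act D.coact x r (B 1)
  one_mul : ∀ v, D.mul (B 0 ⊗ₜ[k] v) = v
  mul_one : ∀ v, D.mul (v ⊗ₜ[k] B 0) = v
  mul_self : D.mul (B 1 ⊗ₜ[k] B 1) = ν • B 1
  comul_one : D.comul (B 0) = B 0 ⊗ₜ[k] B 0
  comul_eq : D.comul (B 1) = B 1 ⊗ₜ[k] B 0 + B 0 ⊗ₜ[k] B 1 + μ • (B 1 ⊗ₜ[k] B 1)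
  counit_one : D.counit (B 0) = 1
  counit_eq : D.counit (B 1) = 0

theorem eq_tmul_add_tmul {A : Type*} [AddCommGroup A] [Module k A]
    (B : Module.Basis (Fin 2) k V) (t : A ⊗[k] V) :
    t = TensorProduct.rid k A ((B.coord 0).lTensor A t) ⊗ₜ[k] B 0 +
      TensorProduct.rid k A ((B.coord 1).lTensor A t) ⊗ₜ[k] B 1 := by
  induction t with
  | zero => simp
  | add s t hs ht =>
    conv_lhs => rw [hs, ht]
    simp only [map_add, TensorProduct.add_tmul]
    abel
  | tmul a v =>
    conv_lhs => rw [← B.sum_repr v, Fin.sum_univ_two, TensorProduct.tmul_add]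
    simp [TensorProduct.smul_tmul']

/-- A nonzero vector of the kernel, which exists by dimension, completes `e` to a basis. Having `φ`
itself as a coordinate later makes the counit axioms read off coefficients. -/
theorem exists_basis_of_counit (hV : Module.finrank k V = 2) (e : V) (φ : V →ₗ[k] k)
    (he : φ e = 1) : ∃ B : Module.Basis (Fin 2) k V, B 0 = e ∧ B.coord 0 = φ := by
  have : FiniteDimensional k V := Module.finite_of_finrank_pos (by omega)
  have hker : LinearMap.ker φ ≠ ⊥ := by
    intro h
    have h1 := LinearMap.finrank_le_finrank_of_injective (LinearMap.ker_eq_bot.1 h)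
    rw [hV, Module.finrank_self] at h1
    omega
  obtain ⟨n, hn, hn0⟩ := Submodule.exists_mem_ne_zero_of_ne_bot hker
  rw [LinearMap.mem_ker] at hn
  have hli : LinearIndependent k ![e, n] := by
    rw [LinearIndependent.pair_iff]
    intro s t hst
    have hs : s = 0 := by simpa [he, hn] using congrArg φ hst
    subst hs
    simpa [hn0] using hst
  let B := basisOfLinearIndependentOfCardEqFinrank hli (by simp [hV])
  have hB : ∀ i, B i = ![e, n] i := fun i => by
    simp [B]
  refine ⟨B, hB 0, B.ext fun i => ?_⟩
  rw [Module.Basis.coord_apply, Module.Basis.repr_self]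
  fin_cases i
  · simp [hB, he]
  · simp [hB, hn]

variable {D : BraidedHopfData k (G → k) V} {E : BraidedHopfData k (G → k) W}
  {B : Module.Basis (Fin 2) k V} {B' : Module.Basis (Fin 2) k W} {x x' : G} {r r' : G → k}
  {ν μ ν' μ' : k}

theorem IsTwoDimForm.iso (hD : IsTwoDimForm D B x r ν μ) (hE : IsTwoDimForm E B' x r ν μ) :
    D.Iso E := by
  have hf : ∀ i, B.equiv B' (Equiv.refl _) (B i) = B' i := fun i => by simp
  set f := B.equiv B' (Equiv.refl _)
  have hmul : f.toLinearMap ∘ₗ D.mul = E.mul ∘ₗ TensorProduct.map f.toLinearMap f.toLinearMap := by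
    refine (B.tensorProduct B).ext fun ⟨i, j⟩ => ?_
    fin_cases i <;> fin_cases j <;>
      simp [hf, hD.one_mul, hD.mul_one, hE.one_mul, hE.mul_one, hD.mul_self, hE.mul_self]
  have hcomul : E.comul ∘ₗ f.toLinearMap =
      TensorProduct.map f.toLinearMap f.toLinearMap ∘ₗ D.comul := by
    refine B.ext fun i => ?_
    fin_cases i
    · simp [hf, hD.comul_one, hE.comul_one]
    · simp [hf, hD.comul_eq, hE.comul_eq]
  have hcounit : E.counit ∘ₗ f.toLinearMap = D.counit := by
    refine B.ext fun i => ?_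
    fin_cases i
    · simp [hf, hD.counit_one, hE.counit_one]
    · simp [hf, hD.counit_eq, hE.counit_eq]
  refine ⟨f, IsYDHom.of_span B.span_eq fun i => ?_, fun v w => ?_, ?_, LinearMap.congr_fun hcomul,
    LinearMap.congr_fun hcounit⟩
  · fin_cases i
    · exact ⟨1, 1, hD.isEigenvector_one, by simpa [hf] using hE.isEigenvector_one⟩
    · exact ⟨x, r, hD.isEigenvector, by simpa [hf] using hE.isEigenvector⟩
  · exact LinearMap.congr_fun hmul (v ⊗ₜ[k] w)
  · rw [hD.one_eq, hE.one_eq, hf]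

/-- An isomorphism preserves the counit, so it sends `n` to a multiple of the other generator, and
eigenvectors on one line have the same type. -/
theorem IsTwoDimForm.eq_of_iso (hD : IsTwoDimForm D B x r ν μ) (hE : IsTwoDimForm E B' x' r' ν' μ')
    (h : D.Iso E) : x = x' ∧ r = r' := by
  obtain ⟨f, hf, -, -, -, hε⟩ := h
  have h1 := hf.map_isEigenvector hD.isEigenvector
  rw [LinearEquiv.coe_coe] at h1
  have h2 : f (B 1) = B'.repr (f (B 1)) 1 • B' 1 := by
    have h3 : f (B 1) = _ := (B'.sum_repr (f (B 1))).symm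
    rw [Fin.sum_univ_two] at h3
    have h4 := hε (B 1)
    rw [hD.counit_eq, h3] at h4
    have h5 : B'.repr (f (B 1)) 0 = 0 := by
      simpa [hE.counit_one, hE.counit_eq] using h4
    conv_lhs => rw [h3, h5, zero_smul, zero_add]
  refine IsEigenvector.unique ?_ h1 (h2 ▸ hE.isEigenvector.smul _)
  simpa using B.ne_zero 1

theorem IsTwoDimForm.exists_antipode (hD : IsTwoDimForm D B x r 0 0) :
    ∃ S : V →ₗ[k] V, IsYDHom D.act D.coact D.act D.coact S ∧
      (∀ v : V, D.mul (S.rTensor V (D.comul v)) = D.counit v • D.one) ∧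
      (∀ v : V, D.mul (S.lTensor V (D.comul v)) = D.counit v • D.one) := by
  -- For primitive `n` the antipode must be `n ↦ -n`.
  let S := B.constr k ![B 0, -B 1]
  have hS0 : S (B 0) = B 0 := by simp [S]
  have hS1 : S (B 1) = -B 1 := by simp [S]
  refine ⟨S, IsYDHom.of_span B.span_eq fun i => ?_,
    LinearMap.congr_fun (f := D.mul ∘ₗ S.rTensor V ∘ₗ D.comul) (g := D.counit.smulRight D.one)
      (B.ext fun i => ?_),
    LinearMap.congr_fun (f := D.mul ∘ₗ S.lTensor V ∘ₗ D.comul) (g := D.counit.smulRight D.one)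
      (B.ext fun i => ?_)⟩ <;> fin_cases i
  · exact ⟨1, 1, hD.isEigenvector_one, by simpa [hS0] using hD.isEigenvector_one⟩
  · refine ⟨x, r, hD.isEigenvector, ?_⟩
    simpa [hS1] using hD.isEigenvector.smul (-1)
  · simp [hD.comul_one, hS0, hD.one_mul, hD.counit_one, hD.one_eq]
  · simp [hD.comul_eq, hS0, hS1, hD.one_mul, hD.mul_one, hD.counit_eq, TensorProduct.neg_tmul]
  · simp [hD.comul_one, hS0, hD.one_mul, hD.counit_one, hD.one_eq]
  · simp [hD.comul_eq, hS0, hS1, hD.one_mul, hD.mul_one, hD.counit_eq, TensorProduct.tmul_neg]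

variable {ω : G → G → G → kˣ} {hω : IsNormalizedThreeCocycle ω}

/-- The hypothesis says that `n` and `n ⊗ n` have the same type. An idempotent of a group is `1`;
normalization then removes `ω`, leaving `r(z)² = r(z)` with `r(z)` nonzero. -/
theorem IsTwoDimForm.eq_one_of_mul_self_eq (hω : IsNormalizedThreeCocycle ω)
    (hr : ∀ y, r y ≠ 0)
    (h : x * x = x ∧ (fun z => ω x x z * r z * (ω x z x : k)⁻¹ * r z * ω z x x) = r) :
    x = 1 ∧ r = 1 := by
  obtain ⟨h1, h2⟩ := h
  obtain rfl : x = 1 := by simpa using h1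
  refine ⟨rfl, funext fun z => ?_⟩
  have h3 := congr_fun h2 z
  simp only [hω.one_left, hω.one_right, Units.val_one, inv_one] at h3
  exact mul_left_cancel₀ (hr z) (by simpa using h3)

variable [Fintype G] [DecidableEq G]

theorem isEigenvector_trivial (v : V) : IsEigenvector ((funQuasiBialgebra ω hω).trivialAct V)
    (trivialCoact k (G → k) V) 1 1 v :=
  ⟨fun _ => rfl, rfl⟩

theorem IsBraidedHopf.exists_isTwoDimForm {D : BraidedHopfData k (G → k) V}
    (hD : IsBraidedHopf (funQuasiBialgebra ω hω) D) (hV : Module.finrank k V = 2) :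
    ∃ B x r ν μ, IsTwoDimForm D B x r ν μ := by
  obtain ⟨B, hB0, hcoord⟩ := exists_basis_of_counit hV D.one D.counit hD.counit_one
  have hε : D.counit (B 1) = 0 := by
    rw [← hcoord]
    simp
  have hspan : ∀ v, D.counit v = 0 → v = B.coord 1 v • B 1 := by
    intro v hv
    rw [← hcoord] at hv
    conv_lhs => rw [← B.sum_repr v]
    rw [Fin.sum_univ_two, ← B.coord_apply, hv, zero_smul, zero_add, B.coord_apply]
  obtain ⟨x, hx⟩ := exists_isHomogeneous D.act (B.ne_zero 1) fun f =>
    ⟨_, hspan _ (by rw [hD.counit_hom.map_act, hε, map_zero])⟩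
  have hco : D.counit.lTensor _ (D.coact (B 1)) = 0 := by
    rw [← hD.counit_hom.map_coact, hε, map_zero]
  refine ⟨B, x, TensorProduct.rid k _ ((B.coord 1).lTensor _ (D.coact (B 1))),
    B.coord 1 (D.mul (B 1 ⊗ₜ[k] B 1)), B.coord 1
    (TensorProduct.rid k V ((B.coord 1).lTensor V (D.comul (B 1)))), hB0.symm, ?_, ⟨hx, ?_⟩, ?_, ?_,
    hspan _ (by rw [hD.counit_mul, hε, mul_zero]), ?_, ?_, ?_, hε⟩
  · rw [hB0]
    simpa using hD.one_hom.map_isEigenvector (isEigenvector_trivial (1 : k))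
  · have h := eq_tmul_add_tmul B (D.coact (B 1))
    rw [hcoord, hco, map_zero, TensorProduct.zero_tmul, zero_add] at h
    exact h
  · rw [hB0]; exact hD.one_mul
  · rw [hB0]; exact hD.mul_one
  · rw [hB0]; exact hD.comul_one
  · have h := eq_tmul_add_tmul B (D.comul (B 1))
    rw [hcoord, hD.comul_counit] at h
    -- At this point `Δ(n) = n ⊗ 1 + w ⊗ n`; applying the counit on the left gives `ε(w) = 1`, so `w
    -- = 1 + μ n`.
    set w := TensorProduct.rid k V ((B.coord 1).lTensor V (D.comul (B 1))) with hw
    have h1 := hD.counit_comul (B 1)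
    rw [h] at h1
    simp only [map_add, LinearMap.rTensor_tmul, TensorProduct.lid_tmul, hε, zero_smul,
      zero_add] at h1
    have h2 : D.counit w = 1 := by
      have := congrArg (B.coord 1) h1
      simpa using this
    have h3 : w = B 0 + B.coord 1 w • B 1 := by
      conv_lhs => rw [← B.sum_repr w]
      rw [Fin.sum_univ_two, ← B.coord_apply, hcoord, h2, one_smul, B.coord_apply]
    rw [h]
    conv_lhs => rw [h3]
    rw [TensorProduct.add_tmul, TensorProduct.smul_tmul', add_assoc]
  · rw [hB0]; exact hD.counit_one

/-! ### Constraints on degree, coaction and structure constants -/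

theorem IsTwoDimForm.coact_one (hD : IsTwoDimForm D B x r ν μ)
    (hY : (funQuasiBialgebra ω hω).IsYetterDrinfeld D.act D.coact) : r 1 = 1 := by
  have h := hY.counit_coact (B 1)
  rw [hD.isEigenvector.coact_eq, LinearMap.rTensor_tmul, TensorProduct.lid_tmul] at h
  exact smul_left_injective k (B.ne_zero 1) (h.trans (one_smul k _).symm)

theorem IsTwoDimForm.coact_mul (hD : IsTwoDimForm D B x r ν μ)
    (hY : (funQuasiBialgebra ω hω).IsYetterDrinfeld D.act D.coact) (y z : G) :
    r y * ω y x z * r z = ω x y z * r (y * z) * ω y z x := by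
  have h := hY.coact_coassoc (B 1)
  rw [coact_coassoc_lhs hD.isEigenvector, coact_coassoc_rhs hD.isEigenvector] at h
  exact congr_fun₂ (sum_sum_pt_tmul_ext (B.ne_zero 1) h) y z

/-- In the coassociativity relation at `(y, y⁻¹)` one side is a product of units, because `r(1) =
1`, and the other is divisible by `r(y)`. -/
theorem IsTwoDimForm.coact_ne_zero (hD : IsTwoDimForm D B x r ν μ)
    (hY : (funQuasiBialgebra ω hω).IsYetterDrinfeld D.act D.coact) (y : G) : r y ≠ 0 := by
  intro h
  have h1 := hD.coact_mul hY y y⁻¹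
  rw [mul_inv_cancel, hD.coact_one hY, h] at h1
  simp at h1

theorem IsTwoDimForm.mem_center (hD : IsTwoDimForm D B x r ν μ)
    (hY : (funQuasiBialgebra ω hω).IsYetterDrinfeld D.act D.coact) : x ∈ Subgroup.center G := by
  rw [Subgroup.mem_center_iff]
  intro y
  -- Tested with the delta function at `xy` and evaluated at `y`, one side is `r(y) ≠ 0` and the
  -- other vanishes unless `yx = xy`.
  have h := hY.act_coact (pt k (x * y)) (B 1)
  have h := congr_fun (tmul_right_injective (B.ne_zero 1)
    ((act_coact_lhs hD.isEigenvector _).symm.trans (h.trans (act_coact_rhs hD.isEigenvector _)))) y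
  by_contra hne
  simp [pt, hne, (hD.coact_ne_zero hY y).symm] at h

/-- Multiplication is a morphism, so the nonzero vector `ν n` has the type of `n ⊗ n` as well as
that of `n`. -/
theorem IsTwoDimForm.eq_one_of_mul (hD : IsTwoDimForm D B x r ν μ)
    (hH : IsBraidedHopf (funQuasiBialgebra ω hω) D) (hν : ν ≠ 0) : x = 1 ∧ r = 1 := by
  refine eq_one_of_mul_self_eq hω (hD.coact_ne_zero hH.yetterDrinfeld) ?_
  have h := hH.mul_hom.map_isEigenvector (hD.isEigenvector.tmul (hω := hω) hD.isEigenvector)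
  rw [hD.mul_self] at h
  exact h.unique (smul_ne_zero hν (B.ne_zero 1)) (hD.isEigenvector.smul ν)

theorem isEigenvector_tmul_one (hD : IsTwoDimForm D B x r ν μ) :
    IsEigenvector ((funQuasiBialgebra ω hω).tensorModule D.act D.act)
      ((funQuasiBialgebra ω hω).tensorCoact D.act D.coact D.act D.coact) x r
      (B 1 ⊗ₜ[k] B 0) := by
  have h := hD.isEigenvector.tmul (hω := hω) hD.isEigenvector_one
  simpa [hω.one_left, hω.one_mid, hω.one_right] using h

theorem isEigenvector_one_tmul (hD : IsTwoDimForm D B x r ν μ) :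
    IsEigenvector ((funQuasiBialgebra ω hω).tensorModule D.act D.act)
      ((funQuasiBialgebra ω hω).tensorCoact D.act D.coact D.act D.coact) x r
      (B 0 ⊗ₜ[k] B 1) := by
  have h := hD.isEigenvector_one.tmul (hω := hω) hD.isEigenvector
  simpa [hω.one_left, hω.one_mid, hω.one_right] using h

theorem isEigenvector_one_tmul_one (hD : IsTwoDimForm D B x r ν μ) :
    IsEigenvector ((funQuasiBialgebra ω hω).tensorModule D.act D.act)
      ((funQuasiBialgebra ω hω).tensorCoact D.act D.coact D.act D.coact) 1 1
      (B 0 ⊗ₜ[k] B 0) := by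
  have h := hD.isEigenvector_one.tmul (hω := hω) hD.isEigenvector_one
  simpa [hω.one_left, hω.one_mid, hω.one_right, Pi.one_def] using h

/-- `Δ(n)`, `n ⊗ 1` and `1 ⊗ n` all have the type of `n`, hence so does the remaining term `μ n ⊗
n`. -/
theorem IsTwoDimForm.eq_one_of_comul (hD : IsTwoDimForm D B x r ν μ)
    (hH : IsBraidedHopf (funQuasiBialgebra ω hω) D) (hμ : μ ≠ 0) : x = 1 ∧ r = 1 := by
  refine eq_one_of_mul_self_eq hω (hD.coact_ne_zero hH.yetterDrinfeld) ?_
  have h := hH.comul_hom.map_isEigenvector hD.isEigenvector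
  rw [hD.comul_eq] at h
  have h := (h.sub (isEigenvector_tmul_one hD)).sub (isEigenvector_one_tmul hD)
  rw [add_assoc, add_sub_cancel_left, add_sub_cancel_left] at h
  have h0 : B 1 ⊗ₜ[k] B 1 ≠ 0 := by
    simpa using (B.tensorProduct B).ne_zero (1, 1)
  exact ((hD.isEigenvector.tmul (hω := hω) hD.isEigenvector).smul μ).unique
    (smul_ne_zero hμ h0) h

/-- The square of `Δ(n)`. -/
theorem IsTwoDimForm.tensorMul_comul (hD : IsTwoDimForm D B x r ν μ) (hr : r 1 = 1)
    (h : x = 1 ∧ r = 1 ∨ μ = 0) :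
    (funQuasiBialgebra ω hω).tensorMul D (D.comul (B 1) ⊗ₜ[k] D.comul (B 1)) =
      ν • (B 1 ⊗ₜ[k] B 0 + B 0 ⊗ₜ[k] B 1) +
        (1 + r x + 4 * (μ * ν) + (μ * ν) ^ 2) • (B 1 ⊗ₜ[k] B 1) := by
  have h0 := hD.isEigenvector_one
  have h1 := hD.isEigenvector
  have a0 := h0.homogeneous
  have a1 := h1.homogeneous
  -- Each alternative makes all values of `ω` trivial: either every degree is `1`, or every product
  -- that occurs involves a factor `1`. The term `r x` comes from braiding `n` past `n`.
  obtain ⟨rfl, rfl⟩ | rfl := h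
  · simp only [hD.comul_eq, TensorProduct.add_tmul, TensorProduct.tmul_add, map_add,
      TensorProduct.tmul_smul, ← TensorProduct.smul_tmul', map_smul, tensorMul_tmul a1 h0 a1 a0,
      tensorMul_tmul a1 h0 a0 a1, tensorMul_tmul a0 h1 a1 a0, tensorMul_tmul a0 h1 a0 a1,
      tensorMul_tmul a1 h1 a0 a1, tensorMul_tmul a1 h1 a1 a0, tensorMul_tmul a0 h1 a1 a1,
      tensorMul_tmul a1 h0 a1 a1, tensorMul_tmul a1 h1 a1 a1, hω.one_left,
      hD.mul_one, hD.one_mul, hD.mul_self, Units.val_one, inv_one, _root_.mul_one, Pi.one_apply]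
    module
  · simp only [hD.comul_eq, zero_smul, add_zero, TensorProduct.add_tmul, TensorProduct.tmul_add,
      map_add, TensorProduct.tmul_smul, ← TensorProduct.smul_tmul', tensorMul_tmul a1 h0 a1 a0,
      tensorMul_tmul a1 h0 a0 a1, tensorMul_tmul a0 h1 a1 a0, tensorMul_tmul a0 h1 a0 a1,
      hω.one_left, hω.one_mid, hω.one_right, hD.mul_one, hD.one_mul, hD.mul_self, Units.val_one,
      hr, inv_one, _root_.mul_one, _root_.one_mul, Pi.one_apply]
    module

theorem IsTwoDimForm.one_add_coact_eq (hD : IsTwoDimForm D B x r ν μ)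
    (hH : IsBraidedHopf (funQuasiBialgebra ω hω) D) (h : x = 1 ∧ r = 1 ∨ μ = 0) :
    1 + r x + 3 * (μ * ν) + (μ * ν) ^ 2 = 0 := by
  have h1 := LinearMap.congr_fun hH.comul_mul (B 1 ⊗ₜ[k] B 1)
  rw [LinearMap.comp_apply, LinearMap.comp_apply, TensorProduct.map_tmul, hD.tensorMul_comul
    (hD.coact_one hH.yetterDrinfeld) h,
    hD.mul_self, map_smul, hD.comul_eq, smul_add, add_right_inj, smul_smul] at h1
  have h0 : B 1 ⊗ₜ[k] B 1 ≠ 0 := by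
    simpa using (B.tensorProduct B).ne_zero (1, 1)
  have h2 := smul_left_injective k h0 h1
  linear_combination -h2

/-- The antipode axiom at `n` forces `S(n) = s n` with `s (1 + μν) = -1`. -/
theorem IsTwoDimForm.one_add_mul_ne_zero (hD : IsTwoDimForm D B x r ν μ)
    (hH : IsBraidedHopf (funQuasiBialgebra ω hω) D) : 1 + μ * ν ≠ 0 := by
  obtain ⟨S, -, hS, -⟩ := hH.exists_antipode
  have h0 : S (B 0) = B 0 := by
    have h := hS (B 0)
    rwa [hD.comul_one, LinearMap.rTensor_tmul, hD.mul_one, hD.counit_one, one_smul,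
      hD.one_eq] at h
  have h1 := hS (B 1)
  rw [hD.comul_eq, hD.counit_eq, zero_smul] at h1
  simp only [map_add, map_smul, LinearMap.rTensor_tmul, hD.mul_one, h0, hD.one_mul] at h1
  rw [← B.sum_repr (S (B 1)), Fin.sum_univ_two] at h1
  set c := B.repr (S (B 1)) 0
  set s := B.repr (S (B 1)) 1
  simp only [TensorProduct.add_tmul, ← TensorProduct.smul_tmul', map_add, map_smul, hD.one_mul,
    hD.mul_self] at h1
  have e0 : c = 0 := by simpa using congrArg (B.coord 0) h1
  have e1 : s + 1 + (μ * c + μ * (s * ν)) = 0 := by simpa using congrArg (B.coord 1) h1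
  intro h
  rw [e0] at e1
  exact one_ne_zero (α := k) (by linear_combination e1 - s * h)

/-- The group algebra `k[C₂]` is of the form above, for each prescribed `μ ≠ 0`. -/
theorem exists_isTwoDimForm_trivialC2 (hμ : μ ≠ 0) :
    ∃ B : Module.Basis (Fin 2) k (MonoidAlgebra k (Multiplicative (ZMod 2))),
      IsTwoDimForm (trivialC2 (funQuasiBialgebra ω hω)) B 1 1 (-2 / μ) μ := by
  let T : MonoidAlgebra k (Multiplicative (ZMod 2)) :=
    MonoidAlgebra.single (Multiplicative.ofAdd 1) 1
  have hT : T * T = 1 := by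
    rw [MonoidAlgebra.single_mul_single, MonoidAlgebra.one_def]
    congr 1
    exact _root_.mul_one 1
  have hΔT : Coalgebra.comul (R := k) T = T ⊗ₜ[k] T := by
    simp [T]
  have hΔ1 : Coalgebra.comul (R := k) (1 : MonoidAlgebra k (Multiplicative (ZMod 2))) =
      1 ⊗ₜ[k] 1 := by
    simp [MonoidAlgebra.one_def]
  have hεT : Coalgebra.counit (R := k) T = 1 := by
    simp [T]
  have hε1 : Coalgebra.counit (R := k) (1 : MonoidAlgebra k (Multiplicative (ZMod 2))) = 1 := by
    simp [MonoidAlgebra.one_def]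
  -- `T - 1` spans the augmentation ideal; scaling it by `μ⁻¹` makes the coefficient of `n ⊗ n` in
  -- `Δ(n)` equal to `μ`.
  have hli : LinearIndependent k ![1, μ⁻¹ • (T - 1)] := by
    rw [LinearIndependent.pair_iff]
    intro s t hst
    have hs : s = 0 := by
      simpa [hεT, hε1] using congrArg (Coalgebra.counit (R := k)) hst
    have hT1 : T - 1 ≠ 0 := by
      rw [sub_ne_zero, MonoidAlgebra.one_def]
      intro h
      have := congrArg (fun f => f.coeff 1) h
      simp [T] at this
    subst hs
    simpa [hT1, hμ] using hst
  let B := basisOfLinearIndependentOfCardEqFinrank hli (by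
    rw [Module.finrank_eq_card_basis (MonoidAlgebra.basis (Multiplicative (ZMod 2)) k)]
    rfl)
  have hB0 : B 0 = 1 := by simp [B]
  have hB1 : B 1 = μ⁻¹ • (T - 1) := by simp [B]
  refine ⟨B, hB0.symm, isEigenvector_trivial _, isEigenvector_trivial _, fun v => ?_, fun v => ?_,
    ?_, ?_, ?_, ?_, ?_⟩
  · rw [hB0]
    exact one_mul v
  · rw [hB0]
    exact mul_one v
  · change B 1 * B 1 = _
    rw [hB1, smul_mul_smul_comm, sub_mul, mul_sub, hT, mul_one, one_mul]
    match_scalars <;> field_simp <;> ring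
  · rw [hB0]
    exact hΔ1
  · change Coalgebra.comul (R := k) (B 1) = _
    rw [hB0, hB1, map_smul, map_sub, hΔT, hΔ1]
    simp only [TensorProduct.tmul_smul, ← TensorProduct.smul_tmul', TensorProduct.tmul_sub,
      TensorProduct.sub_tmul]
    match_scalars <;> field_simp <;> ring
  · rw [hB0]
    exact hε1
  · change Coalgebra.counit (R := k) (B 1) = _
    rw [hB1, map_smul, map_sub, hεT, hε1, sub_self, smul_zero]

end TwoDimensional

/-! ### Braided Hopf algebras from pairs, and exclusion of the other normal forms -/

section PairHopf

variable {k : Type u} [Field k] {G : Type v} [Group G] [Fintype G] [DecidableEq G]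
  {V : Type*} [AddCommGroup V] [Module k V] {ω : G → G → G → kˣ}
  {hω : IsNormalizedThreeCocycle ω} {D : BraidedHopfData k (G → k) V}
  {B : Module.Basis (Fin 2) k V} {x : G} {r : G → k}

theorem isYetterDrinfeld_of_basis {ι : Type*} {a : (G → k) →ₐ[k] Module.End k V}
    {c : V →ₗ[k] (G → k) ⊗[k] V} (B : Module.Basis ι k V)
    (h : ∀ i, ∃ x r, IsEigenvector a c x r (B i) ∧ x ∈ Subgroup.center G ∧ r 1 = 1 ∧
      ∀ y z, r y * ω y x z * r z = ω x y z * r (y * z) * ω y z x) :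
    (funQuasiBialgebra ω hω).IsYetterDrinfeld a c := by
  constructor
  · refine LinearMap.congr_fun (f := (TensorProduct.lid k V).toLinearMap ∘ₗ
      (funQuasiBialgebra ω hω).counit.toLinearMap.rTensor V ∘ₗ c) (g := LinearMap.id)
      (B.ext fun i => ?_)
    obtain ⟨x, r, hB, -, hr, -⟩ := h i
    simp only [LinearMap.comp_apply, hB.coact_eq, LinearMap.rTensor_tmul, LinearEquiv.coe_coe,
      TensorProduct.lid_tmul]
    exact (congrArg (· • B i) hr).trans (one_smul k _)
  · refine LinearMap.congr_fun (f := (halfBraid c (Algebra.lmul k (G → k))).lTensor (G → k) ∘ₗ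
        (funQuasiBialgebra ω hω).associator (Algebra.lmul k (G → k)) a (Algebra.lmul k (G → k)) ∘ₗ
        (halfBraid c (Algebra.lmul k (G → k))).rTensor (G → k) ∘ₗ
        (TensorProduct.mk k _ (G → k)).flip 1 ∘ₗ (TensorProduct.mk k V (G → k)).flip 1)
      (g := (funQuasiBialgebra ω hω).associator (Algebra.lmul k (G → k))
          (Algebra.lmul k (G → k)) a ∘ₗ
        halfBraid c ((funQuasiBialgebra ω hω).tensorModule (Algebra.lmul k (G → k))
          (Algebra.lmul k (G → k))) ∘ₗ
        (funQuasiBialgebra ω hω).associator a (Algebra.lmul k (G → k)) (Algebra.lmul k (G → k)) ∘ₗ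
        (TensorProduct.mk k _ (G → k)).flip 1 ∘ₗ (TensorProduct.mk k V (G → k)).flip 1)
      (B.ext fun i => ?_)
    obtain ⟨x, r, hB, -, -, hr⟩ := h i
    refine (coact_coassoc_lhs hB).trans (Eq.trans ?_ (coact_coassoc_rhs hB).symm)
    simp only [hr]
  · intro f
    refine LinearMap.congr_fun (f := tensorAct (Algebra.lmul k (G → k)) a (funComul k G f) ∘ₗ c)
      (g := halfBraid c (Algebra.lmul k (G → k)) ∘ₗ
        tensorAct a (Algebra.lmul k (G → k)) (funComul k G f) ∘ₗ
        (TensorProduct.mk k V (G → k)).flip 1) (B.ext fun i => ?_)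
    obtain ⟨x, r, hB, hx, -⟩ := h i
    refine (act_coact_lhs hB f).trans (Eq.trans ?_ (act_coact_rhs hB f).symm)
    simp only [Subgroup.mem_center_iff.1 hx]

/-- Only the square of `n` imposes a condition: `Δ(n)² = (1 + r(x)) n ⊗ n` must vanish, which is
what `r(x) = -1` achieves. -/
theorem IsTwoDimForm.comul_mul (hD : IsTwoDimForm D B x r 0 0) (hr : r 1 = 1) (hx : r x = -1) :
    D.comul ∘ₗ D.mul =
      (funQuasiBialgebra ω hω).tensorMul D ∘ₗ TensorProduct.map D.comul D.comul := by
  have h0 := hD.isEigenvector_one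
  have h1 := hD.isEigenvector
  have a0 := h0.homogeneous
  have a1 := h1.homogeneous
  refine (B.tensorProduct B).ext fun ⟨i, j⟩ => ?_
  simp only [Module.Basis.tensorProduct_apply, LinearMap.comp_apply, TensorProduct.map_tmul]
  fin_cases i <;> fin_cases j <;> simp only [Fin.zero_eta, Fin.mk_one]
  · simp [hD.comul_one, tensorMul_tmul a0 h0 a0 a0, hω.one_left, hD.one_mul]
  · simp [hD.comul_one, hD.comul_eq, TensorProduct.tmul_add, tensorMul_tmul a0 h0 a1 a0,
      tensorMul_tmul a0 h0 a0 a1, hω.one_left, hω.one_mid, hD.one_mul]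
  · simp [hD.comul_one, hD.comul_eq, TensorProduct.add_tmul, tensorMul_tmul a1 h0 a0 a0,
      tensorMul_tmul a0 h1 a0 a0, hω.one_left, hω.one_mid, hD.mul_one, hr]
  · rw [hD.tensorMul_comul hr (Or.inr rfl), hD.mul_self, hx]
    simp

/-- The associator can be nontrivial only on `n ⊗ n ⊗ n`, where both products are zero. -/
theorem IsTwoDimForm.mul_assoc (hD : IsTwoDimForm D B x r 0 0) :
    D.mul ∘ₗ D.mul.rTensor V =
      D.mul ∘ₗ D.mul.lTensor V ∘ₗ (funQuasiBialgebra ω hω).associator D.act D.act D.act := by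
  have a0 := hD.isEigenvector_one.homogeneous
  have a1 := hD.isEigenvector.homogeneous
  refine ((B.tensorProduct B).tensorProduct B).ext fun ⟨⟨i, j⟩, l⟩ => ?_
  simp only [Module.Basis.tensorProduct_apply, LinearMap.comp_apply, LinearMap.rTensor_tmul]
  fin_cases i <;> fin_cases j <;> fin_cases l <;> simp only [Fin.zero_eta, Fin.mk_one]
  · simp [associator_tmul a0 a0 a0, hω.one_left, hD.one_mul]
  · simp [associator_tmul a0 a0 a1, hω.one_left, hD.one_mul]
  · simp [associator_tmul a0 a1 a0, hω.one_left, hD.one_mul, hD.mul_one]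
  · simp [associator_tmul a0 a1 a1, hω.one_left, hD.one_mul, hD.mul_self]
  · simp [associator_tmul a1 a0 a0, hω.one_mid, hD.mul_one]
  · simp [associator_tmul a1 a0 a1, hω.one_mid, hD.mul_one, hD.one_mul]
  · simp [associator_tmul a1 a1 a0, hω.one_right, hD.mul_one, hD.mul_self]
  · simp [associator_tmul a1 a1 a1, hD.mul_self]

theorem IsTwoDimForm.comul_coassoc (hD : IsTwoDimForm D B x r 0 0) :
    (funQuasiBialgebra ω hω).associator D.act D.act D.act ∘ₗ D.comul.rTensor V ∘ₗ D.comul =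
      D.comul.lTensor V ∘ₗ D.comul := by
  have a0 := hD.isEigenvector_one.homogeneous
  have a1 := hD.isEigenvector.homogeneous
  refine B.ext fun i => ?_
  fin_cases i
  · simp [hD.comul_one, associator_tmul a0 a0 a0, hω.one_left]
  · simp [hD.comul_one, hD.comul_eq, associator_tmul a1 a0 a0, associator_tmul a0 a1 a0,
      associator_tmul a0 a0 a1, hω.one_left, hω.one_mid, TensorProduct.add_tmul,
      TensorProduct.tmul_add, add_assoc]

theorem IsTwoDimForm.isBraidedHopf (hD : IsTwoDimForm D B x r 0 0) (hc : x ∈ Subgroup.center G)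
    (hr : r 1 = 1) (hx : r x = -1)
    (hmul : ∀ y z, r y * ω y x z * r z = ω x y z * r (y * z) * ω y z x) :
    IsBraidedHopf (funQuasiBialgebra ω hω) D where
  yetterDrinfeld := isYetterDrinfeld_of_basis B fun i => by
    fin_cases i
    · exact ⟨1, 1, hD.isEigenvector_one, Subgroup.one_mem _, rfl,
        by simp [hω.one_left, hω.one_mid, hω.one_right]⟩
    · exact ⟨x, r, hD.isEigenvector, hc, hr, hmul⟩
  mul_hom := IsYDHom.of_span (B.tensorProduct B).span_eq fun ⟨i, j⟩ => by
    rw [Module.Basis.tensorProduct_apply]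
    fin_cases i <;> fin_cases j <;> simp only [Fin.zero_eta, Fin.mk_one]
    · exact ⟨1, 1, isEigenvector_one_tmul_one hD, by
        rw [hD.one_mul]; exact hD.isEigenvector_one⟩
    · exact ⟨x, r, isEigenvector_one_tmul hD, by rw [hD.one_mul]; exact hD.isEigenvector⟩
    · exact ⟨x, r, isEigenvector_tmul_one hD, by rw [hD.mul_one]; exact hD.isEigenvector⟩
    -- Zero is an eigenvector of every type, so `n² = 0` puts no condition on the type of `n ⊗ n`.
    · exact ⟨_, _, hD.isEigenvector.tmul hD.isEigenvector, by
        rw [hD.mul_self, zero_smul]; exact .zero⟩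
  one_hom := IsYDHom.of_span (Module.Basis.singleton Unit k).span_eq fun i => by
    refine ⟨1, 1, isEigenvector_trivial _, ?_⟩
    simpa [hD.one_eq] using hD.isEigenvector_one
  one_mul := hD.one_eq ▸ hD.one_mul
  mul_one := hD.one_eq ▸ hD.mul_one
  mul_assoc := hD.mul_assoc
  comul_hom := IsYDHom.of_span B.span_eq fun i => by
    fin_cases i <;> simp only [Fin.zero_eta, Fin.mk_one]
    · exact ⟨1, 1, hD.isEigenvector_one, by
        rw [hD.comul_one]; exact isEigenvector_one_tmul_one hD⟩
    · refine ⟨x, r, hD.isEigenvector, ?_⟩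
      rw [hD.comul_eq, zero_smul, add_zero]
      exact (isEigenvector_tmul_one hD).add (isEigenvector_one_tmul hD)
  counit_hom := IsYDHom.of_span B.span_eq fun i => by
    fin_cases i <;> simp only [Fin.zero_eta, Fin.mk_one]
    · exact ⟨1, 1, hD.isEigenvector_one, isEigenvector_trivial _⟩
    · exact ⟨x, r, hD.isEigenvector, by rw [hD.counit_eq]; exact .zero⟩
  counit_comul := LinearMap.congr_fun
    (f := (TensorProduct.lid k V).toLinearMap ∘ₗ D.counit.rTensor V ∘ₗ D.comul)
    (g := LinearMap.id) <| B.ext fun i => by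
      fin_cases i <;> simp [hD.comul_one, hD.comul_eq, hD.counit_one, hD.counit_eq]
  comul_counit := LinearMap.congr_fun
    (f := (TensorProduct.rid k V).toLinearMap ∘ₗ D.counit.lTensor V ∘ₗ D.comul)
    (g := LinearMap.id) <| B.ext fun i => by
      fin_cases i <;> simp [hD.comul_one, hD.comul_eq, hD.counit_one, hD.counit_eq]
  comul_coassoc := hD.comul_coassoc
  comul_one := by rw [hD.one_eq, hD.comul_one]
  comul_mul := hD.comul_mul hr hx
  counit_one := by rw [hD.one_eq, hD.counit_one]
  counit_mul v w := by
    refine LinearMap.congr_fun (f := D.counit ∘ₗ D.mul)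
      (g := LinearMap.mul' k k ∘ₗ TensorProduct.map D.counit D.counit)
      ((B.tensorProduct B).ext fun ⟨i, j⟩ => ?_) (v ⊗ₜ[k] w)
    fin_cases i <;> fin_cases j <;>
      simp [hD.one_mul, hD.mul_one, hD.mul_self, hD.counit_one, hD.counit_eq]
  exists_antipode := hD.exists_antipode

theorem finrank_dualNumber : Module.finrank k (DualNumber k) = 2 :=
  (Module.finrank_prod (R := k) (M := k) (M' := k)).trans (by simp)

theorem exists_isTwoDimForm_pairData (x : G) (ρ : G → kˣ) :
    ∃ B : Module.Basis (Fin 2) k (DualNumber k),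
      IsTwoDimForm (pairData ω hω x ρ) B x (fun y => (ρ y : k)) 0 0 := by
  have hli : LinearIndependent k ![1, (DualNumber.eps : DualNumber k)] := by
    rw [LinearIndependent.pair_iff]
    intro s t hst
    exact ⟨by simpa using congrArg TrivSqZeroExt.fst hst,
      by simpa using congrArg TrivSqZeroExt.snd hst⟩
  let B := basisOfLinearIndependentOfCardEqFinrank hli (by
    rw [finrank_dualNumber]; rfl)
  have hB0 : B 0 = 1 := by simp [B]
  have hB1 : B 1 = DualNumber.eps := by simp [B]
  refine ⟨B, hB0.symm, ⟨fun f => ?_, ?_⟩, ⟨fun f => ?_, ?_⟩, fun v => ?_, fun v => ?_, ?_, ?_, ?_,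
    ?_, ?_⟩
  all_goals simp only [hB0, hB1, pairData, twoDimData]
  · simp [funQuasiBialgebra]
  · simp
  · simp
  · simp
  · exact one_mul v
  · exact mul_one v
  · simp
  · simp
  · simp
  · simp
  · simp

theorem IsNontrivialTwoDim.exists_isTwoDimForm (hk : (2 : k) ≠ 0)
    (hD : IsNontrivialTwoDim (funQuasiBialgebra ω hω) D) :
    ∃ (B : Module.Basis (Fin 2) k V) (x : G) (r : G → k), IsTwoDimForm D B x r 0 0 := by
  obtain ⟨B, x, r, ν, μ, h⟩ := hD.isHopf.exists_isTwoDimForm hD.finrank_eq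
  by_cases h0 : ν = 0 ∧ μ = 0
  · obtain ⟨rfl, rfl⟩ := h0
    exact ⟨B, x, r, h⟩
  · have h1 : x = 1 ∧ r = 1 := by
      by_cases hν : ν = 0
      · exact h.eq_one_of_comul hD.isHopf fun hμ => h0 ⟨hν, hμ⟩
      · exact h.eq_one_of_mul hD.isHopf hν
    have h2 := h.one_add_coact_eq hD.isHopf (.inl h1)
    have h3 := h.one_add_mul_ne_zero hD.isHopf
    obtain ⟨rfl, rfl⟩ := h1
    -- With `r = 1` the quadratic factors as `(1 + μν)(2 + μν)`, and the antipode makes the first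
    -- factor invertible.
    have h4 : μ * ν = -2 := by
      refine mul_left_cancel₀ h3 ?_
      rw [Pi.one_apply] at h2
      linear_combination h2
    -- Characteristic different from `2` enters here: `μ = 0` would give `0 = -2`.
    have hμ : μ ≠ 0 := by
      rintro rfl
      exact hk (by linear_combination h4)
    obtain ⟨B', h'⟩ := exists_isTwoDimForm_trivialC2 (hω := hω) hμ
    obtain rfl : ν = -2 / μ := by rw [← h4, mul_div_cancel_left₀ _ hμ]
    exact absurd (h.iso h') hD.nontrivial

end PairHopf

/-- Clearing denominators turns the coboundary condition into the relation that coassociativity of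
the coaction imposes on its coefficient. -/
theorem flat_eq_coboundary_iff {k : Type u} [Field k] {G : Type v} [Group G]
    {ω : G → G → G → kˣ} {x : G} {ρ : G → kˣ} : flat x ω = coboundary ρ ↔
      ∀ y z, (ρ y * ω y x z * ρ z : k) = ω x y z * ρ (y * z) * ω y z x := by
  simp only [funext_iff, flat, coboundary]
  refine forall₂_congr fun y z => ?_
  rw [div_eq_iff_eq_mul, _root_.mul_assoc, _root_.mul_assoc, eq_inv_mul_iff_mul_eq, eq_comm]
  norm_cast
  refine Eq.congr ?_ ?_ <;> ac_rfl

/-! ### The bijection between pairs and isomorphism classes -/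

section Classification

variable {k : Type u} [Field k] {G : Type v} [Group G] [Fintype G] [DecidableEq G]
  {ω : G → G → G → kˣ} {hω : IsNormalizedThreeCocycle ω}

theorem FlatPair.isNontrivialTwoDim (hk : (2 : k) ≠ 0) (p : FlatPair ω) :
    IsNontrivialTwoDim (funQuasiBialgebra ω hω) (pairData ω hω p.1.1 p.1.2) := by
  obtain ⟨⟨x, ρ⟩, hx, h1, hneg, hflat⟩ := p
  obtain ⟨B, hB⟩ := exists_isTwoDimForm_pairData (hω := hω) x ρ
  refine ⟨hB.isBraidedHopf hx (by simp_all) (by simp_all) (flat_eq_coboundary_iff.1 hflat),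
    finrank_dualNumber, fun h => hk ?_⟩
  obtain ⟨B', hB'⟩ := exists_isTwoDimForm_trivialC2 (hω := hω) (one_ne_zero (α := k))
  -- An isomorphism with `k[C₂]` would make `ρ` constantly `1`, contradicting `ρ(x) = -1` since `2 ≠
  -- 0`.
  have h2 := congr_fun (hB.eq_of_iso hB' h).2 x
  simp only at hneg
  simp only [hneg, Units.val_neg, Units.val_one, Pi.one_apply] at h2
  linear_combination -h2

/-- The class of the braided Hopf algebra of a pair. -/
def FlatPair.toClass (hk : (2 : k) ≠ 0) (hω : IsNormalizedThreeCocycle ω) (p : FlatPair ω) :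
    NontrivialTwoDimClasses (funQuasiBialgebra ω hω) :=
  Quotient.mk (nontrivialTwoDimSetoid (funQuasiBialgebra ω hω))
    ⟨DualNumber k, pairData ω hω p.1.1 p.1.2, p.isNontrivialTwoDim hk⟩

theorem FlatPair.toClass_injective (hk : (2 : k) ≠ 0) (hω : IsNormalizedThreeCocycle ω) :
    Function.Injective (FlatPair.toClass hk hω) := by
  intro p q h
  obtain ⟨B, hB⟩ := exists_isTwoDimForm_pairData (hω := hω) p.1.1 p.1.2
  obtain ⟨B', hB'⟩ := exists_isTwoDimForm_pairData (hω := hω) q.1.1 q.1.2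
  obtain ⟨h1, h2⟩ := hB.eq_of_iso hB' (Quotient.exact h)
  exact Subtype.ext (Prod.ext h1 (funext fun y => Units.ext (congr_fun h2 y)))

theorem FlatPair.toClass_surjective (hk : (2 : k) ≠ 0) (hω : IsNormalizedThreeCocycle ω) :
    Function.Surjective (FlatPair.toClass hk hω) := by
  intro c
  induction c using Quotient.inductionOn with
  | _ C =>
    obtain ⟨B, x, r, h⟩ := C.isNontrivial.exists_isTwoDimForm hk
    have hH := C.isNontrivial.isHopf
    have hY := hH.yetterDrinfeld
    let ρ : G → kˣ := fun y => Units.mk0 (r y) (h.coact_ne_zero hY y)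
    have hρ : (fun y => (ρ y : k)) = r := rfl
    refine ⟨⟨(x, ρ), h.mem_center hY, Units.ext (h.coact_one hY), Units.ext ?_,
      flat_eq_coboundary_iff.2 (h.coact_mul hY)⟩, Quotient.sound ?_⟩
    -- With `ν = μ = 0` the quadratic relation reduces to `1 + r(x) = 0`.
    · have := h.one_add_coact_eq hH (.inr rfl)
      simp only [ρ, Units.val_mk0, Units.val_neg, Units.val_one]
      linear_combination this
    · obtain ⟨B', h'⟩ := exists_isTwoDimForm_pairData (hω := hω) x ρ
      exact h'.iso (hρ ▸ h)

end Classification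

theorem mainTheorem6 {k : Type u} [Field k] (hk : (2 : k) ≠ 0)
    {G : Type v} [Group G] [Fintype G] [DecidableEq G]
    (ω : G → G → G → kˣ) (hω : IsNormalizedThreeCocycle ω) :
    ∃ e : FlatPair ω ≃ NontrivialTwoDimClasses (funQuasiBialgebra ω hω),
      ∀ p : FlatPair ω,
        ∃ h : IsNontrivialTwoDim (funQuasiBialgebra ω hω) (pairData ω hω p.1.1 p.1.2),
          e p = Quotient.mk (nontrivialTwoDimSetoid (funQuasiBialgebra ω hω))
            ⟨DualNumber k, pairData ω hω p.1.1 p.1.2, h⟩ :=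
  ⟨Equiv.ofBijective (FlatPair.toClass hk hω)
    ⟨FlatPair.toClass_injective hk hω, FlatPair.toClass_surjective hk hω⟩,
    fun p => ⟨p.isNontrivialTwoDim hk, rfl⟩⟩
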